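/- Let $n\ge 1$ and $0\le K\le n$ be integers, $J=n-K$ and $\sigma>0$. Consider the measurement model $Y=BX+N$, where $X\sim\mathcal N(0,I_n)$ and $N\sim\mathcal N(0,\sigma^2 I_n)$ are independent, and $B=\mathrm{diag}(B_1,\dots,B_n)$ with $B_i\in\{0,1\}$ and $\sum_{i=1}^n B_i=K$ is a random matrix independent of $(X,N)$ whose support is uniformly distributed: $\mathbb P(\{i: B_i=1\}=S)=1/\binom nK$ for every $S\subset\{1,\dots,n\}$ with $|S|=K$. Let $$\mathrm{mmse}=\mathrm{mmse}(n,K,\sigma)=\mathbb E\Big[\big(\|X\|-\mathbb E[\|X\|\mid Y]\big)^2\Big]$$ be the mean square error of the MMSE estimator $\mathbb E[\|X\|\mid Y]$ of the Euclidean norm $\|X\|$. Write $B(a,b)=\Gamma(a)\Gamma(b)/\Gamma(a+b)$ for the beta function and ${}_3F_2(a_1,a_2,a_3;b_1,b_2;x)=\sum_{k\ge 0}\frac{(a_1)_k(a_2)_k(a_3)_k}{(b_1)_k(b_2)_k}\frac{x^k}{k!}$ for the hypergeometric series, with $(a)_0=1$ and $(a)_k=a(a+1)\cdots(a+k-1)$.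 Then: 1. For fixed $n$ and $K$, the series below converges and $$\lim_{\sigma\to 0^+}\mathrm{mmse}=n-(n+J)\,\frac{B\left(\frac{n+J}{2},\frac{n+1}{2}\right)}{B\left(\frac{n+J+1}{2},\frac n2\right)}\;{}_3F_2\left(\frac{n+1}{2},\frac J2,-\frac12;\frac{n+J+1}{2},\frac n2;1\right).$$ 2. For fixed $n$ and $K$, $$\lim_{\sigma\to\infty}\mathrm{mmse}=n-2\left(\frac{\Gamma\left(\frac{n+1}{2}\right)}{\Gamma\left(\frac n2\right)}\right)^2 .$$ 3. For fixed $\sigma>0$ and any sequences of integers $n_j\to\infty$ and $1\le K_j\le n_j$ (that is, $K_j/n_j\in[1/n_j,1]$; in particular whenever $K_j/n_j=p$ is a constant), $$\lim_{j\to\infty}\frac{\mathrm{mmse}(n_j,K_j,\sigma)}{n_j}=0 .$$ -/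

import Mathlib

open MeasureTheory ProbabilityTheory Filter Topology

universe u

noncomputable section

/-- The `k`-th term `(a₁)_k ⋯ (a_p)_k / ((b₁)_k ⋯ (b_q)_k) * x ^ k / k!` of the generalized
hypergeometric series, where `(c)_k = c (c + 1) ⋯ (c + k - 1)`. -/
def hypergeometricTerm (a b : List ℝ) (x : ℝ) (k : ℕ) : ℝ :=
  (a.map fun c => (ascPochhammer ℝ k).eval c).prod /
      (b.map fun c => (ascPochhammer ℝ k).eval c).prod *
    (x ^ k / (k.factorial : ℝ))

/-- The generalized hypergeometric function `_pF_q(a₁, …, a_p; b₁, …, b_q; x)`. -/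
def hypergeometricPFQ (a b : List ℝ) (x : ℝ) : ℝ :=
  ∑' k : ℕ, hypergeometricTerm a b x k

/-- The random vectors of the measurement model `Y = B X + N`, on an arbitrary probability space:
`X ∼ 𝒩(0, I_n)`, `N ∼ 𝒩(0, σ² I_n)` and `B = diag(B₁, …, B_n)` with `B_i ∈ {0, 1}` and
`∑ B_i = K`; `X` and `N` are independent, `B` is independent of `(X, N)`, and the support of
`B` is uniform among the `K`-element subsets of the index set. -/
structure MeasurementModel (n K : ℕ) (σ : ℝ) where
  /-- the sample space -/
  Ω : Type u
  /-- the events -/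
  [measurableSpace : MeasurableSpace Ω]
  /-- the probability -/
  P : Measure Ω
  [isProbabilityMeasure : IsProbabilityMeasure P]
  /-- the input vector -/
  X : Ω → EuclideanSpace ℝ (Fin n)
  /-- the noise vector -/
  N : Ω → EuclideanSpace ℝ (Fin n)
  /-- the diagonal entries `B₁, …, B_n` of `B` -/
  b : Ω → Fin n → ℝ
  measurable_X : Measurable X
  measurable_N : Measurable N
  measurable_b : Measurable b
  law_X : P.map X = multivariateGaussian 0 (1 : Matrix (Fin n) (Fin n) ℝ)
  law_N : P.map N = multivariateGaussian 0 (σ ^ 2 • (1 : Matrix (Fin n) (Fin n) ℝ))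
  b_zero_or_one : ∀ ω i, b ω i = 0 ∨ b ω i = 1
  sum_b : ∀ ω, ∑ i, b ω i = K
  prob_support_b : ∀ S : Finset (Fin n), S.card = K →
    P {ω | Function.support (b ω) = (S : Set (Fin n))} = 1 / (n.choose K : ENNReal)
  indep_X_N : IndepFun X N P
  indep_b_XN : IndepFun b (fun ω => (X ω, N ω)) P

namespace MeasurementModel

attribute [instance] MeasurementModel.measurableSpace MeasurementModel.isProbabilityMeasure

variable {n K : ℕ} {σ : ℝ}

/-- The measurement `Y = B X + N`. -/
def Y (M : MeasurementModel.{u} n K σ) (ω : M.Ω) : EuclideanSpace ℝ (Fin n) :=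
  Matrix.toEuclideanLin (Matrix.diagonal (M.b ω)) (M.X ω) + M.N ω

/-- The MMSE estimator `E[‖X‖ | Y]` of the Euclidean norm of the input. -/
def estimator (M : MeasurementModel.{u} n K σ) : M.Ω → ℝ :=
  M.P[fun ω => ‖M.X ω‖ | MeasurableSpace.comap M.Y inferInstance]

/-- The mean square error `E[(‖X‖ - E[‖X‖ | Y])²]` of the MMSE estimator. -/
def mmse (M : MeasurementModel.{u} n K σ) : ℝ :=
  ∫ ω, (‖M.X ω‖ - M.estimator ω) ^ 2 ∂M.P

end MeasurementModel

end

/-!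
Since the random projection `B` is independent of `(X, N)`, it suffices to bound the mean square
error for each fixed value of `B`.

Even without noise, the norm of `X` can only be estimated from `B X` by its conditional mean
`condMeanNorm J ‖B X‖`, so the mean square error is at least `n - E[condMeanNorm J ‖B X‖ ^ 2]`.
This conditional mean is 1-Lipschitz in `‖B X‖`, so applying it to `‖Y‖` misses that bound by at
most `|σ| √n` in `L²`. Its second moment is `E[‖X‖ ‖X'‖]`, where `X'` shares the projection `B X`
with `X` and is otherwise independent. With `v` the standard Gaussian vector formed by `X` and
`(1 - B) X'`, this is the mean of `‖X‖ √(‖v‖ ^ 2 - ‖(1 - B) X‖ ^ 2)`; expanding the square root in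
powers of `‖(1 - B) X‖ / ‖v‖` gives the hypergeometric series, because the direction of `v` is
independent of `‖v‖`.

For strong noise, a rotation of the pair `(X, N)` in the range of `B` produces a standard Gaussian
vector that is independent of `Y` and close to `X` in `L²`, so the mean square error tends to the
variance of `‖X‖`. That variance bounds the mean square error at every noise level, and it is at
most `2` because `(‖X‖ - √n) ^ 2 ≤ (‖X‖ ^ 2 - n) ^ 2 / n`.
-/

section SquareIntegrable

variable {α β : Type*} {mα : MeasurableSpace α} {mβ : MeasurableSpace β} {μ : Measure α}
  {ν : Measure β}

lemma integral_sub_condExp_sq_le {m : MeasurableSpace α} (hm : m ≤ mα) [IsFiniteMeasure μ]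
    {f h : α → ℝ} (hf : MemLp f 2 μ) (hh : MemLp h 2 μ) (hhm : StronglyMeasurable[m] h) :
    ∫ ω, (f ω - (μ[f | m]) ω) ^ 2 ∂μ ≤ ∫ ω, (f ω - h ω) ^ 2 ∂μ := by
  have hresidual : f - h - μ[f - h | m] =ᵐ[μ] f - μ[f | m] := by
    filter_upwards [condExp_sub (hf.integrable one_le_two) (hh.integrable one_le_two) m] with ω hω
    simp only [Pi.sub_apply, hω,
      condExp_of_stronglyMeasurable hm hhm (hh.integrable one_le_two)]
    ring
  calc ∫ ω, (f ω - (μ[f | m]) ω) ^ 2 ∂μ = ∫ ω, Var[f - h; μ | m] ω ∂μ := by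
        rw [condVar, integral_condExp hm]
        refine integral_congr_ae ?_
        filter_upwards [hresidual] with ω hω
        rw [Pi.pow_apply, hω, Pi.sub_apply]
    _ ≤ ∫ ω, (μ[(f - h) ^ 2 | m]) ω ∂μ :=
        integral_mono_ae integrable_condVar integrable_condExp
          (condVar_ae_le_condExp_sq hm (hf.sub hh))
    _ = ∫ ω, (f ω - h ω) ^ 2 ∂μ := integral_condExp hm

lemma sq_lpNorm_two {f : α → ℝ} (hf : AEStronglyMeasurable f μ) :
    lpNorm f 2 μ ^ 2 = ∫ ω, f ω ^ 2 ∂μ := by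
  have hnonneg : 0 ≤ ∫ ω, f ω ^ 2 ∂μ := integral_nonneg fun _ => sq_nonneg _
  rw [lpNorm_eq_integral_norm_rpow_toReal two_ne_zero ENNReal.ofNat_ne_top hf]
  simpa using Real.rpow_inv_natCast_pow hnonneg two_ne_zero

lemma integral_sub_const_sq [IsProbabilityMeasure μ] {f : α → ℝ} (hf : MemLp f 2 μ) (c : ℝ) :
    ∫ ω, (f ω - c) ^ 2 ∂μ = Var[f; μ] + (∫ ω, f ω ∂μ - c) ^ 2 := by
  have hmean : ∫ ω, (f ω - c) ∂μ = ∫ ω, f ω ∂μ - c := by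
    rw [integral_sub (hf.integrable one_le_two) (integrable_const c)]
    simp
  have hvar := variance_eq_sub (X := fun ω => f ω - c) (hf.sub (memLp_const c))
  rw [variance_sub_const hf.1, hmean] at hvar
  simp only [Pi.pow_apply] at hvar
  linarith

lemma memLp_prodMk_left_ae [SFinite μ] [SFinite ν] {f : α × β → ℝ} (hf : MemLp f 2 (μ.prod ν)) :
    ∀ᵐ x ∂μ, MemLp (fun y => f (x, y)) 2 ν := by
  filter_upwards [hf.integrable_sq.prod_right_ae, hf.1.prodMk_left] with x hx hmeas
  exact (memLp_two_iff_integrable_sq hmeas).2 hx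

lemma memLp_integral_prod_left [SFinite μ] [IsProbabilityMeasure ν] {f : α × β → ℝ}
    (hf : MemLp f 2 (μ.prod ν)) : MemLp (fun x => ∫ y, f (x, y) ∂ν) 2 μ := by
  have hmeas : AEStronglyMeasurable (fun x => ∫ y, f (x, y) ∂ν) μ := hf.1.integral_prod_right'
  refine (memLp_two_iff_integrable_sq hmeas).2
    (hf.integrable_sq.integral_prod_left.mono' (hmeas.pow 2) ?_)
  filter_upwards [memLp_prodMk_left_ae hf] with x hx
  have hvar := variance_nonneg (fun y => f (x, y)) ν
  rw [variance_eq_sub hx] at hvar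
  simp only [Pi.pow_apply] at hvar
  rw [Real.norm_of_nonneg (sq_nonneg _)]
  linarith

lemma integral_sub_comp_fst_sq [IsFiniteMeasure μ] [IsProbabilityMeasure ν] {f : α × β → ℝ}
    (hf : MemLp f 2 (μ.prod ν)) {v : α → ℝ}
    (hv : Integrable (fun p => (f p - v p.1) ^ 2) (μ.prod ν)) :
    ∫ p, (f p - v p.1) ^ 2 ∂μ.prod ν =
      ∫ p, f p ^ 2 ∂μ.prod ν - ∫ x, (∫ y, f (x, y) ∂ν) ^ 2 ∂μ +
        ∫ x, (∫ y, f (x, y) ∂ν - v x) ^ 2 ∂μ := by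
  have hsections : (fun x => ∫ y, (f (x, y) - v x) ^ 2 ∂ν) =ᵐ[μ] fun x =>
      ∫ y, f (x, y) ^ 2 ∂ν - (∫ y, f (x, y) ∂ν) ^ 2 + (∫ y, f (x, y) ∂ν - v x) ^ 2 := by
    filter_upwards [memLp_prodMk_left_ae hf] with x hx
    rw [integral_sub_const_sq hx, variance_eq_sub hx]
    rfl
  have hf_sq := hf.integrable_sq.integral_prod_left
  have hmean_sq := (memLp_integral_prod_left hf).integrable_sq
  have hbias_sq : Integrable (fun x => (∫ y, f (x, y) ∂ν - v x) ^ 2) μ := by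
    refine (hv.integral_prod_left.sub (hf_sq.sub hmean_sq)).congr ?_
    filter_upwards [hsections] with x hx
    simp only [Pi.sub_apply, hx]
    ring
  have hvariance : Integrable (fun x => ∫ y, f (x, y) ^ 2 ∂ν - (∫ y, f (x, y) ∂ν) ^ 2) μ :=
    hf_sq.sub hmean_sq
  rw [integral_prod _ hv, integral_congr_ae hsections, integral_add hvariance hbias_sq,
    integral_sub hf_sq hmean_sq, ← integral_prod _ hf.integrable_sq]

lemma integral_sub_integral_prod_sq [IsFiniteMeasure μ] [IsProbabilityMeasure ν] {f : α × β → ℝ}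
    (hf : MemLp f 2 (μ.prod ν)) :
    ∫ p, (f p - ∫ y, f (p.1, y) ∂ν) ^ 2 ∂μ.prod ν =
      ∫ p, f p ^ 2 ∂μ.prod ν - ∫ x, (∫ y, f (x, y) ∂ν) ^ 2 ∂μ := by
  have hmean : MemLp (fun p : α × β => ∫ y, f (p.1, y) ∂ν) 2 (μ.prod ν) :=
    (memLp_integral_prod_left hf).comp_measurePreserving measurePreserving_fst
  rw [integral_sub_comp_fst_sq (v := fun x => ∫ y, f (x, y) ∂ν) hf (hf.sub hmean).integrable_sq]
  simp only [sub_self, ne_eq, OfNat.ofNat_ne_zero, not_false_eq_true, zero_pow, integral_zero,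
    add_zero]

lemma integral_sq_sub_le_integral_sub_comp_fst_sq [IsFiniteMeasure μ] [IsProbabilityMeasure ν]
    {f : α × β → ℝ} (hf : MemLp f 2 (μ.prod ν)) {v : α → ℝ}
    (hv : Integrable (fun p => (f p - v p.1) ^ 2) (μ.prod ν)) :
    ∫ p, f p ^ 2 ∂μ.prod ν - ∫ x, (∫ y, f (x, y) ∂ν) ^ 2 ∂μ ≤
      ∫ p, (f p - v p.1) ^ 2 ∂μ.prod ν := by
  rw [integral_sub_comp_fst_sq hf hv]
  exact le_add_of_nonneg_right (integral_nonneg fun _ => sq_nonneg _)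

end SquareIntegrable

section GaussianIsometry

variable {E F : Type*} [NormedAddCommGroup E] [InnerProductSpace ℝ E] [FiniteDimensional ℝ E]
  [MeasurableSpace E] [BorelSpace E] [NormedAddCommGroup F] [InnerProductSpace ℝ F]
  [FiniteDimensional ℝ F] [MeasurableSpace F] [BorelSpace F]

lemma measurePreserving_stdGaussian (e : E ≃ₗᵢ[ℝ] F) :
    MeasurePreserving e (stdGaussian E) (stdGaussian F) :=
  ⟨e.continuous.measurable, stdGaussian_map e⟩

lemma measurePreserving_toLp_stdGaussian :
    MeasurePreserving (WithLp.toLp 2) ((stdGaussian E).prod (stdGaussian F))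
      (stdGaussian (WithLp 2 (E × F))) := by
  refine ⟨WithLp.measurable_toLp 2 (E × F), Measure.ext_of_charFun ?_⟩
  ext t
  have hnorm : (‖t‖ : ℂ) ^ 2 = (‖t.fst‖ : ℂ) ^ 2 + (‖t.snd‖ : ℂ) ^ 2 := by
    exact_mod_cast WithLp.prod_norm_sq_eq_of_L2 t
  simp only [charFun_prod, charFun_stdGaussian, ← Complex.exp_add, hnorm, WithLp.ofLp_fst,
    WithLp.ofLp_snd]
  ring_nf

lemma integral_stdGaussian_withLp_prod (f : WithLp 2 (E × F) → ℝ) :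
    ∫ v, f v ∂stdGaussian (WithLp 2 (E × F)) =
      ∫ p, f (WithLp.toLp 2 p) ∂(stdGaussian E).prod (stdGaussian F) :=
  (measurePreserving_toLp_stdGaussian.integral_comp
    (MeasurableEquiv.toLp 2 (E × F)).measurableEmbedding f).symm

lemma integral_stdGaussian_withLp_fst (f : E → ℝ) :
    ∫ v, f v.fst ∂stdGaussian (WithLp 2 (E × F)) = ∫ x, f x ∂stdGaussian E := by
  simpa [integral_stdGaussian_withLp_prod] using
    integral_fun_fst (μ := stdGaussian E) (ν := stdGaussian F) f

lemma integral_stdGaussian_withLp_snd (f : F → ℝ) :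
    ∫ v, f v.snd ∂stdGaussian (WithLp 2 (E × F)) = ∫ y, f y ∂stdGaussian F := by
  simpa [integral_stdGaussian_withLp_prod] using
    integral_fun_snd (μ := stdGaussian E) (ν := stdGaussian F) f

lemma measurePreserving_add_stdGaussian (U : Submodule ℝ E) :
    MeasurePreserving (fun p : U × Uᗮ => (p.1 + p.2 : E))
      ((stdGaussian U).prod (stdGaussian Uᗮ)) (stdGaussian E) := by
  have h := (measurePreserving_stdGaussian U.orthogonalDecomposition.symm).comp
    measurePreserving_toLp_stdGaussian
  refine (funext fun p => ?_ : (fun p : U × Uᗮ => (p.1 + p.2 : E)) = _) ▸ h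
  exact (U.orthogonalDecomposition_symm_apply _).symm

lemma measurePreserving_prod_stdGaussian_of_norm_sq (T : E × F →ₗ[ℝ] E × F)
    (hT : ∀ p, ‖(T p).1‖ ^ 2 + ‖(T p).2‖ ^ 2 = ‖p.1‖ ^ 2 + ‖p.2‖ ^ 2) :
    MeasurePreserving T ((stdGaussian E).prod (stdGaussian F))
      ((stdGaussian E).prod (stdGaussian F)) := by
  let e := WithLp.linearEquiv 2 ℝ (E × F)
  let isometry : WithLp 2 (E × F) →ₗᵢ[ℝ] WithLp 2 (E × F) :=
    { toLinearMap := e.symm.toLinearMap ∘ₗ T ∘ₗ e.toLinearMap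
      norm_map' := fun v => by
        rw [← sq_eq_sq₀ (norm_nonneg _) (norm_nonneg _), WithLp.prod_norm_sq_eq_of_L2,
          WithLp.prod_norm_sq_eq_of_L2]
        exact hT (e v) }
  have hlp : MeasurePreserving (MeasurableEquiv.toLp 2 (E × F))
      ((stdGaussian E).prod (stdGaussian F)) (stdGaussian (WithLp 2 (E × F))) :=
    measurePreserving_toLp_stdGaussian
  exact (hlp.symm.comp
    (measurePreserving_stdGaussian (isometry.toLinearIsometryEquiv rfl))).comp hlp

lemma integral_comp_norm_stdGaussian_congr
    (h : Module.finrank ℝ E = Module.finrank ℝ F) (φ : ℝ → ℝ) :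
    ∫ x, φ ‖x‖ ∂stdGaussian E = ∫ y, φ ‖y‖ ∂stdGaussian F := by
  have e := (stdOrthonormalBasis ℝ E).equiv (stdOrthonormalBasis ℝ F) (finCongr h)
  simpa using (measurePreserving_stdGaussian e).integral_comp
    e.toHomeomorph.measurableEmbedding (fun y => φ ‖y‖)

end GaussianIsometry

section GaussianDensity

variable {E : Type*} [NormedAddCommGroup E] [InnerProductSpace ℝ E]

/-- The density of the standard Gaussian measure with respect to the Lebesgue measure. -/
noncomputable def stdGaussianPDF (x : E) : ℝ :=
  ((2 * Real.pi) ^ ((Module.finrank ℝ E : ℝ) / 2))⁻¹ * Real.exp (-(1 / 2) * ‖x‖ ^ 2)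

lemma stdGaussianPDF_nonneg (x : E) : 0 ≤ stdGaussianPDF x := by
  unfold stdGaussianPDF
  positivity

lemma continuous_stdGaussianPDF : Continuous (stdGaussianPDF : E → ℝ) := by
  unfold stdGaussianPDF
  fun_prop

variable [FiniteDimensional ℝ E] [MeasurableSpace E] [BorelSpace E]

lemma integral_stdGaussianPDF_mul_cexp (t : E) :
    ∫ x, (stdGaussianPDF x : ℂ) * Complex.exp (inner ℝ x t * Complex.I) =
      Complex.exp (-‖t‖ ^ 2 / 2) := by
  have hfourier := GaussianFourier.integral_cexp_neg_mul_sq_norm_add (V := E) (b := 1 / 2)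
    (by norm_num) Complex.I t
  have hintegrand : ∀ x : E, (stdGaussianPDF x : ℂ) * Complex.exp (inner ℝ x t * Complex.I) =
      (((2 * Real.pi) ^ ((Module.finrank ℝ E : ℝ) / 2) : ℝ) : ℂ)⁻¹ *
        Complex.exp (-(1 / 2) * (‖x‖ : ℂ) ^ 2 + Complex.I * inner ℝ t x) := fun x => by
    rw [stdGaussianPDF, Complex.exp_add, real_inner_comm]
    push_cast
    rw [mul_comm Complex.I]
    ring
  have hnormalization : ((Real.pi : ℂ) / (1 / 2)) ^ ((Module.finrank ℝ E : ℂ) / 2) =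
      ((2 * Real.pi) ^ ((Module.finrank ℝ E : ℝ) / 2) : ℝ) := by
    rw [Complex.ofReal_cpow (by positivity)]
    push_cast
    ring_nf
  simp_rw [hintegrand]
  rw [integral_const_mul, hfourier, hnormalization, inv_mul_cancel_left₀, Complex.I_sq]
  · ring_nf
  · exact Complex.ofReal_ne_zero.2 (by positivity)

lemma integrable_stdGaussianPDF : Integrable (stdGaussianPDF : E → ℝ) := by
  have hexp : Integrable fun x : E => Real.exp (-(1 / 2) * ‖x‖ ^ 2) := by
    refine (GaussianFourier.integrable_cexp_neg_mul_sq_norm_add (V := E) (b := 1 / 2)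
      (by norm_num) 0 0).re.congr (.of_forall fun x => ?_)
    norm_num [← Complex.ofReal_pow, Complex.exp_re]
  exact hexp.const_mul _

lemma stdGaussian_eq_withDensity :
    stdGaussian E = volume.withDensity fun x => ENNReal.ofReal (stdGaussianPDF x) := by
  have : IsFiniteMeasure ((volume : Measure E).withDensity
      fun x => ENNReal.ofReal (stdGaussianPDF x)) :=
    isFiniteMeasure_withDensity_ofReal integrable_stdGaussianPDF.2
  refine (Measure.ext_of_charFun ?_).symm
  ext t
  rw [charFun_stdGaussian, charFun_apply, integral_withDensity_eq_integral_toReal_smul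
    (continuous_stdGaussianPDF.measurable.ennreal_ofReal) (by simp)]
  simp_rw [ENNReal.toReal_ofReal (stdGaussianPDF_nonneg _), Complex.real_smul]
  exact integral_stdGaussianPDF_mul_cexp t

lemma integral_stdGaussian_eq_integral_mul (f : E → ℝ) :
    ∫ x, f x ∂stdGaussian E = ∫ x, f x * stdGaussianPDF x := by
  rw [stdGaussian_eq_withDensity, integral_withDensity_eq_integral_toReal_smul
    (continuous_stdGaussianPDF.measurable.ennreal_ofReal) (by simp)]
  simp_rw [ENNReal.toReal_ofReal (stdGaussianPDF_nonneg _), smul_eq_mul, mul_comm]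

end GaussianDensity

section GaussianNorm

variable {E : Type*} [NormedAddCommGroup E] [InnerProductSpace ℝ E] [FiniteDimensional ℝ E]
  [MeasurableSpace E] [BorelSpace E]

lemma memLp_norm_stdGaussian {p : ENNReal} (hp : p ≠ ⊤) :
    MemLp (fun x : E => ‖x‖) p (stdGaussian E) :=
  (IsGaussian.memLp_id (stdGaussian E) p hp).norm

lemma integral_angular_mul_radial [Nontrivial E] {h : E → ℝ} (ψ : ℝ → ℝ)
    (hh : ∀ (r : ℝ) (x : E), 0 < r → h (r • x) = h x) :
    ∫ x : E, h x * ψ ‖x‖ = (∫ θ, h θ ∂(volume : Measure E).toSphere) *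
      ∫ r, ψ r ∂Measure.volumeIoiPow (Module.finrank ℝ E - 1) := by
  have hpunctured : ∫ x : E, h x * ψ ‖x‖ = ∫ x : ({(0)}ᶜ : Set E), h x.1 * ψ ‖x.1‖
      ∂((volume : Measure E).comap (↑)) := by
    rw [integral_subtype_comap (measurableSet_singleton _).compl fun x => h x * ψ ‖x‖,
      restrict_compl_singleton]
  rw [hpunctured, ← integral_prod_mul (fun θ : Metric.sphere (0 : E) 1 => h θ)
    (fun r : Set.Ioi (0 : ℝ) => ψ r),
    ← (volume : Measure E).measurePreserving_homeomorphUnitSphereProd.integral_comp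
      (Homeomorph.measurableEmbedding _)]
  refine integral_congr_ae (.of_forall fun x => ?_)
  have hx : (0 : ℝ) < ‖(x : E)‖⁻¹ := inv_pos.2 (norm_pos_iff.2 x.2)
  simp [hh _ _ hx]

lemma integral_stdGaussian_angular_mul_radial [Nontrivial E] {h : E → ℝ} (ψ : ℝ → ℝ)
    (hh : ∀ (r : ℝ) (x : E), 0 < r → h (r • x) = h x) :
    ∫ x, h x * ψ ‖x‖ ∂stdGaussian E =
      (∫ x, h x ∂stdGaussian E) * ∫ x, ψ ‖x‖ ∂stdGaussian E := by
  obtain ⟨radial, hpolar⟩ : ∃ radial : (ℝ → ℝ) → ℝ, ∀ (h : E → ℝ) (ψ : ℝ → ℝ),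
      (∀ (r : ℝ) (x : E), 0 < r → h (r • x) = h x) →
      ∫ x, h x * ψ ‖x‖ ∂stdGaussian E =
        (∫ θ, h θ ∂(volume : Measure E).toSphere) * radial ψ := by
    refine ⟨fun ψ => ∫ r : Set.Ioi (0 : ℝ), ψ r *
      (((2 * Real.pi) ^ ((Module.finrank ℝ E : ℝ) / 2))⁻¹ * Real.exp (-(1 / 2) * (r : ℝ) ^ 2))
        ∂Measure.volumeIoiPow (Module.finrank ℝ E - 1), fun h ψ hh => ?_⟩
    rw [integral_stdGaussian_eq_integral_mul]
    simp_rw [mul_assoc]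
    exact integral_angular_mul_radial (fun r => ψ r *
      (((2 * Real.pi) ^ ((Module.finrank ℝ E : ℝ) / 2))⁻¹ * Real.exp (-(1 / 2) * r ^ 2))) hh
  have hmass := hpolar (fun _ => 1) (fun _ => 1) (by simp)
  have hangular := hpolar h (fun _ => 1) hh
  have hradial := hpolar (fun _ => 1) ψ (by simp)
  simp only [mul_one, integral_const, probReal_univ, smul_eq_mul, one_mul] at hmass hangular hradial
  rw [hpolar h ψ hh, hangular, hradial]
  linear_combination (∫ θ, h θ ∂(volume : Measure E).toSphere) * radial ψ * hmass

lemma integral_comp_norm_stdGaussian [Nontrivial E] (φ : ℝ → ℝ) :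
    ∫ x, φ ‖x‖ ∂stdGaussian E =
      (∫ r in Set.Ioi (0 : ℝ), r ^ (Module.finrank ℝ E - 1) * (φ r * Real.exp (-(1 / 2) * r ^ 2))) /
        ∫ r in Set.Ioi (0 : ℝ), r ^ (Module.finrank ℝ E - 1) * Real.exp (-(1 / 2) * r ^ 2) := by
  obtain ⟨c, hc⟩ : ∃ c : ℝ, ∀ φ : ℝ → ℝ, ∫ x, φ ‖x‖ ∂stdGaussian E = c *
      ∫ r in Set.Ioi (0 : ℝ), r ^ (Module.finrank ℝ E - 1) *
        (φ r * Real.exp (-(1 / 2) * r ^ 2)) := by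
    refine ⟨((2 * Real.pi) ^ ((Module.finrank ℝ E : ℝ) / 2))⁻¹ *
      (Module.finrank ℝ E • (volume : Measure E).real (Metric.ball 0 1)), fun φ => ?_⟩
    simp_rw [integral_stdGaussian_eq_integral_mul, stdGaussianPDF, mul_left_comm (φ _)]
    rw [integral_const_mul, integral_fun_norm_addHaar (volume : Measure E)
      (fun r => φ r * Real.exp (-(1 / 2) * r ^ 2))]
    simp only [smul_eq_mul, nsmul_eq_mul, mul_assoc]
  have hmass := hc fun _ => 1
  simp only [integral_const, probReal_univ, smul_eq_mul, one_mul] at hmass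
  rw [hc φ, eq_div_iff (right_ne_zero_of_mul (hmass ▸ one_ne_zero)), mul_right_comm, ← hmass,
    one_mul]

lemma integral_norm_rpow_stdGaussian [Nontrivial E] {s : ℝ}
    (hs : -(Module.finrank ℝ E : ℝ) < s) :
    ∫ x, ‖x‖ ^ s ∂stdGaussian E = 2 ^ (s / 2) *
      Real.Gamma (((Module.finrank ℝ E : ℝ) + s) / 2) /
        Real.Gamma ((Module.finrank ℝ E : ℝ) / 2) := by
  have hd : 0 < (Module.finrank ℝ E : ℝ) := by exact_mod_cast Module.finrank_pos
  have hpow {s r : ℝ} (hr : 0 < r) :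
      r ^ (Module.finrank ℝ E - 1) * r ^ s = r ^ ((Module.finrank ℝ E : ℝ) - 1 + s) := by
    rw [Real.rpow_add hr, ← Nat.cast_pred Module.finrank_pos, Real.rpow_natCast]
  set d : ℝ := ((Module.finrank ℝ E : ℕ) : ℝ)
  have hradial {s : ℝ} (hs : -d < s) :
      ∫ r in Set.Ioi (0 : ℝ), r ^ (Module.finrank ℝ E - 1) *
        (r ^ s * Real.exp (-(1 / 2) * r ^ 2)) =
      (1 / 2) ^ (-(d + s) / 2) * (1 / 2) * Real.Gamma ((d + s) / 2) := by
    have h := integral_rpow_mul_exp_neg_mul_rpow (p := 2) (q := d - 1 + s) (b := 1 / 2)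
      two_pos (by linarith) (by norm_num)
    rw [show d - 1 + s + 1 = d + s by ring] at h
    rw [← h]
    refine setIntegral_congr_fun measurableSet_Ioi fun r hr => ?_
    simp only [← mul_assoc, hpow hr, Real.rpow_ofNat]
  have hnormalization := hradial (s := 0) (by linarith)
  simp only [Real.rpow_zero, one_mul, add_zero] at hnormalization
  have hscale : ((1 : ℝ) / 2) ^ (-(d + s) / 2) = (1 / 2) ^ (-d / 2) * 2 ^ (s / 2) := by
    rw [show -(d + s) / 2 = -d / 2 + -(s / 2) by ring, Real.rpow_add (by norm_num),
      one_div, Real.inv_rpow two_pos.le (-(s / 2)), ← Real.rpow_neg two_pos.le, neg_neg]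
  rw [integral_comp_norm_stdGaussian (· ^ s), hradial hs, hnormalization, hscale]
  field_simp

end GaussianNorm

section GaussianNormMoments

lemma Gamma_add_nat_eq_ascPochhammer {a : ℝ} (ha : 0 < a) (k : ℕ) :
    Real.Gamma (a + k) = (ascPochhammer ℝ k).eval a * Real.Gamma a := by
  induction k with
  | zero => simp
  | succ k ih =>
    push_cast
    rw [← add_assoc, Real.Gamma_add_one (by positivity), ih, ascPochhammer_succ_eval]
    ring

variable {E : Type*} [NormedAddCommGroup E] [InnerProductSpace ℝ E] [FiniteDimensional ℝ E]
  [MeasurableSpace E] [BorelSpace E]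

lemma integral_norm_pow_stdGaussian [Nontrivial E] (k : ℕ) :
    ∫ x, ‖x‖ ^ k ∂stdGaussian E = 2 ^ ((k : ℝ) / 2) *
      Real.Gamma (((Module.finrank ℝ E : ℝ) + k) / 2) /
        Real.Gamma ((Module.finrank ℝ E : ℝ) / 2) := by
  have hd : 0 < (Module.finrank ℝ E : ℝ) := by exact_mod_cast Module.finrank_pos
  simp_rw [← Real.rpow_natCast]
  exact integral_norm_rpow_stdGaussian (by linarith [k.cast_nonneg (α := ℝ)])

variable (E) in
lemma integral_norm_pow_two_mul_stdGaussian (k : ℕ) :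
    ∫ x, ‖x‖ ^ (2 * k) ∂stdGaussian E =
      2 ^ k * (ascPochhammer ℝ k).eval ((Module.finrank ℝ E : ℝ) / 2) := by
  rcases subsingleton_or_nontrivial E with hE | hE
  · rcases k.eq_zero_or_pos with rfl | hk
    · simp
    · simp [Subsingleton.elim _ (0 : E), Module.finrank_zero_of_subsingleton, hk.ne']
  · have hd : 0 < (Module.finrank ℝ E : ℝ) := by exact_mod_cast Module.finrank_pos
    rw [integral_norm_pow_stdGaussian]
    push_cast
    rw [mul_div_cancel_left₀ _ two_ne_zero, Real.rpow_natCast, add_div,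
      mul_div_cancel_left₀ _ two_ne_zero, Gamma_add_nat_eq_ascPochhammer (by positivity),
      ← mul_assoc, mul_div_cancel_right₀ _ (Real.Gamma_pos_of_pos (by positivity)).ne']

variable (E) in
lemma integral_norm_stdGaussian [Nontrivial E] :
    ∫ x, ‖x‖ ∂stdGaussian E = √2 * (Real.Gamma (((Module.finrank ℝ E : ℝ) + 1) / 2) /
      Real.Gamma ((Module.finrank ℝ E : ℝ) / 2)) := by
  have h := integral_norm_pow_stdGaussian (E := E) 1
  simp only [pow_one, Nat.cast_one, ← Real.sqrt_eq_rpow] at h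
  rw [h, mul_div_assoc]

variable (E) in
lemma integral_norm_stdGaussian_pos [Nontrivial E] : 0 < ∫ x, ‖x‖ ∂stdGaussian E := by
  have hd : 0 < (Module.finrank ℝ E : ℝ) := Nat.cast_pos.2 Module.finrank_pos
  rw [integral_norm_stdGaussian]
  have := Real.Gamma_pos_of_pos (half_pos hd)
  have := Real.Gamma_pos_of_pos (half_pos (add_pos hd one_pos))
  positivity

lemma integral_norm_pow_two_mul_add_one_stdGaussian [Nontrivial E] (k : ℕ) :
    ∫ x, ‖x‖ ^ (2 * k + 1) ∂stdGaussian E =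
      2 ^ k * (ascPochhammer ℝ k).eval (((Module.finrank ℝ E : ℝ) + 1) / 2) *
        ∫ x, ‖x‖ ∂stdGaussian E := by
  have hmean := integral_norm_pow_stdGaussian (E := E) 1
  simp only [pow_one, Nat.cast_one] at hmean
  have hexponent : ((2 * k + 1 : ℕ) : ℝ) / 2 = k + 1 / 2 := by
    push_cast
    ring
  rw [integral_norm_pow_stdGaussian, hmean, add_div, hexponent, ← add_assoc, add_right_comm,
    ← add_div, Gamma_add_nat_eq_ascPochhammer (by positivity), Real.rpow_add two_pos,
    Real.rpow_natCast]
  ring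

variable (E) in
lemma integral_norm_sq_stdGaussian : ∫ x, ‖x‖ ^ 2 ∂stdGaussian E = Module.finrank ℝ E := by
  simpa [mul_div_cancel₀] using integral_norm_pow_two_mul_stdGaussian E 1

lemma memLp_norm_sq_stdGaussian : MemLp (fun x : E => ‖x‖ ^ 2) 2 (stdGaussian E) := by
  refine (memLp_two_iff_integrable_sq (by fun_prop)).2 ?_
  simpa only [← pow_mul, Real.norm_of_nonneg (norm_nonneg _)] using
    (memLp_norm_stdGaussian (E := E) (p := 4) ENNReal.ofNat_ne_top).integrable_norm_pow
      four_ne_zero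

lemma integral_norm_sq_sub_finrank_sq_stdGaussian :
    ∫ x, (‖x‖ ^ 2 - Module.finrank ℝ E) ^ 2 ∂stdGaussian E = 2 * Module.finrank ℝ E := by
  have hfourth : ∫ x, ‖x‖ ^ 4 ∂stdGaussian E =
      (Module.finrank ℝ E : ℝ) ^ 2 + 2 * Module.finrank ℝ E := by
    rw [integral_norm_pow_two_mul_stdGaussian E 2]
    simp only [ascPochhammer_succ_eval, ascPochhammer_zero, Polynomial.eval_one]
    push_cast
    ring
  rw [integral_sub_const_sq memLp_norm_sq_stdGaussian, variance_eq_sub memLp_norm_sq_stdGaussian,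
    integral_norm_sq_stdGaussian]
  simp only [Pi.pow_apply, ← pow_mul]
  rw [hfourth]
  ring

variable (E) in
lemma variance_norm_stdGaussian_le_two : Var[fun x => ‖x‖; stdGaussian E] ≤ 2 := by
  rcases subsingleton_or_nontrivial E with hE | hE
  · have hzero : (fun x : E => ‖x‖) = 0 := funext fun x => by simp [Subsingleton.elim x 0]
    rw [hzero, variance_zero]
    exact zero_le_two
  set d : ℝ := ((Module.finrank ℝ E : ℕ) : ℝ) with hd
  have hd_pos : 0 < d := Nat.cast_pos.2 Module.finrank_pos
  have hnorm : MemLp (fun x : E => ‖x‖) 2 (stdGaussian E) :=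
    memLp_norm_stdGaussian ENNReal.ofNat_ne_top
  have hpointwise (x : E) : (‖x‖ - √d) ^ 2 ≤ (‖x‖ ^ 2 - d) ^ 2 / d := by
    have hsum : d ≤ (‖x‖ + √d) ^ 2 := by
      nlinarith [norm_nonneg x, Real.sqrt_nonneg d, Real.sq_sqrt hd_pos.le]
    calc (‖x‖ - √d) ^ 2 ≤ (‖x‖ - √d) ^ 2 * (‖x‖ + √d) ^ 2 / d :=
          (le_div_iff₀ hd_pos).2 (by gcongr)
      _ = (‖x‖ ^ 2 - d) ^ 2 / d := by
          rw [← mul_pow, mul_comm, ← sq_sub_sq, Real.sq_sqrt hd_pos.le]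
  calc Var[fun x => ‖x‖; stdGaussian E] ≤ ∫ x, (‖x‖ - √d) ^ 2 ∂stdGaussian E := by
        rw [integral_sub_const_sq hnorm]
        exact le_add_of_nonneg_right (sq_nonneg _)
    _ ≤ ∫ x, (‖x‖ ^ 2 - d) ^ 2 / d ∂stdGaussian E :=
        integral_mono (hnorm.sub (memLp_const _)).integrable_sq
          ((memLp_norm_sq_stdGaussian.sub (memLp_const _)).integrable_sq.div_const d) hpointwise
    _ = 2 := by
        rw [integral_div, hd, integral_norm_sq_sub_finrank_sq_stdGaussian,
          mul_div_cancel_right₀ _ hd_pos.ne']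

end GaussianNormMoments

section SqrtSeries

/-- The coefficients `(-1/2)_k / k!` of the power series of `√(1 - u)`. -/
noncomputable def sqrtCoeff (k : ℕ) : ℝ := (ascPochhammer ℝ k).eval (-(1 / 2)) / k.factorial

lemma sqrtCoeff_zero : sqrtCoeff 0 = 1 := by simp [sqrtCoeff]

lemma sqrtCoeff_succ_nonpos (k : ℕ) : sqrtCoeff (k + 1) ≤ 0 := by
  have hfactor : (ascPochhammer ℝ (k + 1)).eval (-(1 / 2)) =
      -(1 / 2) * (ascPochhammer ℝ k).eval (1 / 2) := by
    rw [ascPochhammer_succ_left]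
    norm_num [Polynomial.eval_comp]
  have hpos : 0 < (ascPochhammer ℝ k).eval (1 / 2) := ascPochhammer_pos k _ (by norm_num)
  rw [sqrtCoeff, hfactor]
  exact div_nonpos_of_nonpos_of_nonneg (by linarith) (by positivity)

lemma hasSum_sqrtCoeff_of_lt_one {u : ℝ} (hu : |u| < 1) :
    HasSum (fun k => sqrtCoeff k * u ^ k) √(1 - u) := by
  have hseries := (Real.one_div_one_sub_rpow_hasFPowerSeriesOnBall_zero (-(1 / 2))).hasSum (y := u)
    (by simpa [Metric.mem_eball, edist_eq_enorm_sub, ← ofReal_norm] using hu)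
  have hcoeff (k : ℕ) : sqrtCoeff k = Ring.choose (-(1 / 2) + (k : ℝ) - 1) k := by
    rw [← Ring.multichoose_eq, sqrtCoeff, div_eq_iff (by positivity),
      ← Polynomial.ascPochhammer_smeval_eq_eval,
      ← Ring.factorial_nsmul_multichoose_eq_ascPochhammer, nsmul_eq_mul, mul_comm]
  have hvalue : 1 / (1 - (0 + u)) ^ (-(1 / 2) : ℝ) = √(1 - u) := by
    rw [zero_add, Real.rpow_neg (by linarith [le_abs_self u]), one_div, inv_inv,
      Real.sqrt_eq_rpow]
  rw [hvalue] at hseries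
  simpa only [hcoeff, FormalMultilinearSeries.ofScalars_apply_eq, smul_eq_mul] using hseries

lemma summable_abs_sqrtCoeff : Summable fun k => |sqrtCoeff k| := by
  rw [← summable_nat_add_iff 1]
  refine summable_of_sum_range_le (c := 1) (fun k => abs_nonneg _) fun m => ?_
  have hpartial {u : ℝ} (hu : u ∈ Set.Ioo (0 : ℝ) 1) :
      ∑ k ∈ Finset.range m, |sqrtCoeff (k + 1)| * u ^ (k + 1) ≤ 1 := by
    have htail := ((hasSum_nat_add_iff' 1).2
      (hasSum_sqrtCoeff_of_lt_one ((abs_of_pos hu.1).trans_lt hu.2))).neg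
    simp only [Finset.range_one, Finset.sum_singleton, sqrtCoeff_zero, pow_zero, mul_one,
      ← neg_mul, ← abs_of_nonpos (sqrtCoeff_succ_nonpos _)] at htail
    have hle := sum_le_hasSum (Finset.range m)
      (fun k _ => mul_nonneg (abs_nonneg _) (pow_nonneg hu.1.le _)) htail
    linarith [Real.sqrt_nonneg (1 - u)]
  have hlim : Tendsto (fun u : ℝ => ∑ k ∈ Finset.range m, |sqrtCoeff (k + 1)| * u ^ (k + 1))
      (𝓝[<] 1) (𝓝 (∑ k ∈ Finset.range m, |sqrtCoeff (k + 1)|)) := by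
    refine Tendsto.mono_left ?_ nhdsWithin_le_nhds
    simpa using (show Continuous fun u : ℝ =>
      ∑ k ∈ Finset.range m, |sqrtCoeff (k + 1)| * u ^ (k + 1) by fun_prop).tendsto 1
  refine le_of_tendsto hlim ?_
  filter_upwards [Ioo_mem_nhdsLT (zero_lt_one' ℝ)] with u hu using hpartial hu

lemma hasSum_sqrtCoeff {u : ℝ} (hu0 : 0 ≤ u) (hu1 : u ≤ 1) :
    HasSum (fun k => sqrtCoeff k * u ^ k) √(1 - u) := by
  rcases hu1.lt_or_eq with hu | rfl
  · exact hasSum_sqrtCoeff_of_lt_one ((abs_of_nonneg hu0).trans_lt hu)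
  have hsummable : Summable sqrtCoeff := summable_abs_sqrtCoeff.of_abs
  have habel := Real.tendsto_tsum_powerSeries_nhdsWithin_lt hsummable.hasSum.tendsto_sum_nat
  have hsqrt : Tendsto (fun u : ℝ => √(1 - u)) (𝓝[<] 1) (𝓝 √(1 - 1)) :=
    ((show Continuous fun u : ℝ => √(1 - u) by fun_prop).tendsto 1).mono_left nhdsWithin_le_nhds
  have hlimit : ∑' k, sqrtCoeff k = √(1 - 1) := by
    refine tendsto_nhds_unique habel (hsqrt.congr' ?_)
    filter_upwards [Ioo_mem_nhdsLT (zero_lt_one' ℝ)] with u hu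
    exact (hasSum_sqrtCoeff_of_lt_one ((abs_of_pos hu.1).trans_lt hu.2)).tsum_eq.symm
  simpa [hlimit] using hsummable.hasSum

end SqrtSeries

section CondMeanNorm

/-- The conditional mean of the norm of a standard Gaussian vector, given that the projection of
that vector onto a subspace of codimension `J` has norm `r`. -/
noncomputable def condMeanNorm (J : ℕ) (r : ℝ) : ℝ :=
  ∫ y, √(r ^ 2 + ‖y‖ ^ 2) ∂stdGaussian (EuclideanSpace ℝ (Fin J))

/-- The second moment of the conditional mean `condMeanNorm` of the norm of a standard Gaussian
vector in dimension `K + J`, given its projection onto a subspace of dimension `K`. -/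
noncomputable def condMeanNormSq (K J : ℕ) : ℝ :=
  ∫ x, condMeanNorm J ‖x‖ ^ 2 ∂stdGaussian (EuclideanSpace ℝ (Fin K))

section

variable (E F : Type*) [NormedAddCommGroup E] [InnerProductSpace ℝ E] [FiniteDimensional ℝ E]
  [MeasurableSpace E] [BorelSpace E] [NormedAddCommGroup F] [InnerProductSpace ℝ F]
  [FiniteDimensional ℝ F] [MeasurableSpace F] [BorelSpace F]

lemma condMeanNorm_finrank (r : ℝ) :
    condMeanNorm (Module.finrank ℝ F) r = ∫ y, √(r ^ 2 + ‖y‖ ^ 2) ∂stdGaussian F :=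
  integral_comp_norm_stdGaussian_congr finrank_euclideanSpace_fin fun t => √(r ^ 2 + t ^ 2)

lemma condMeanNormSq_finrank_left (J : ℕ) :
    condMeanNormSq (Module.finrank ℝ E) J = ∫ x, condMeanNorm J ‖x‖ ^ 2 ∂stdGaussian E :=
  integral_comp_norm_stdGaussian_congr finrank_euclideanSpace_fin fun t => condMeanNorm J t ^ 2

end

lemma sqrt_add_sq_le_add_abs_sub (r s a : ℝ) : √(r ^ 2 + a ^ 2) ≤ √(s ^ 2 + a ^ 2) + |r - s| := by
  have htriangle := norm_add_le (!₂[s, a] : EuclideanSpace ℝ (Fin 2)) !₂[r - s, 0]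
  simpa [EuclideanSpace.norm_eq, Fin.sum_univ_two, Real.sqrt_sq_eq_abs] using htriangle

lemma abs_sqrt_add_sq_sub_le (r s a : ℝ) :
    |√(r ^ 2 + a ^ 2) - √(s ^ 2 + a ^ 2)| ≤ |r - s| :=
  abs_sub_le_iff.2 ⟨sub_le_iff_le_add'.2 (sqrt_add_sq_le_add_abs_sub r s a),
    sub_le_iff_le_add'.2 (abs_sub_comm r s ▸ sqrt_add_sq_le_add_abs_sub s r a)⟩

lemma memLp_sqrt_add_sq {α : Type*} {mα : MeasurableSpace α} {μ : Measure α} {p : ENNReal}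
    {f g : α → ℝ} (hf : MemLp f p μ) (hg : MemLp g p μ) :
    MemLp (fun x => √(f x ^ 2 + g x ^ 2)) p μ := by
  refine (hf.norm.add hg.norm).mono ?_ (.of_forall fun x => ?_)
  · exact Real.continuous_sqrt.comp_aestronglyMeasurable ((hf.1.pow 2).add (hg.1.pow 2))
  · rw [Real.norm_of_nonneg (Real.sqrt_nonneg _), Pi.add_apply, Real.norm_of_nonneg (by positivity),
      Real.norm_eq_abs, Real.norm_eq_abs]
    refine Real.sqrt_le_iff.2 ⟨by positivity, ?_⟩
    nlinarith [mul_nonneg (abs_nonneg (f x)) (abs_nonneg (g x)), sq_abs (f x), sq_abs (g x)]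

lemma abs_condMeanNorm_sub_le (J : ℕ) (r s : ℝ) :
    |condMeanNorm J r - condMeanNorm J s| ≤ |r - s| := by
  have hint (r : ℝ) : Integrable (fun y : EuclideanSpace ℝ (Fin J) => √(r ^ 2 + ‖y‖ ^ 2))
      (stdGaussian _) :=
    (memLp_sqrt_add_sq (memLp_const r)
      (memLp_norm_stdGaussian ENNReal.ofNat_ne_top)).integrable one_le_two
  rw [condMeanNorm, condMeanNorm, ← integral_sub (hint r) (hint s)]
  calc |∫ y, (√(r ^ 2 + ‖y‖ ^ 2) - √(s ^ 2 + ‖y‖ ^ 2))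
        ∂stdGaussian (EuclideanSpace ℝ (Fin J))|
      ≤ ∫ y, |√(r ^ 2 + ‖y‖ ^ 2) - √(s ^ 2 + ‖y‖ ^ 2)|
        ∂stdGaussian (EuclideanSpace ℝ (Fin J)) := abs_integral_le_integral_abs
    _ ≤ ∫ _, |r - s| ∂stdGaussian (EuclideanSpace ℝ (Fin J)) :=
        integral_mono ((hint r).sub (hint s)).abs (integrable_const _)
          fun y => abs_sqrt_add_sq_sub_le r s ‖y‖
    _ = |r - s| := by simp

lemma lipschitzWith_condMeanNorm (J : ℕ) : LipschitzWith 1 (condMeanNorm J) :=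
  LipschitzWith.of_dist_le_mul fun r s => by
    simpa [Real.dist_eq] using abs_condMeanNorm_sub_le J r s

lemma continuous_condMeanNorm (J : ℕ) : Continuous (condMeanNorm J) :=
  (lipschitzWith_condMeanNorm J).continuous

lemma memLp_condMeanNorm {α : Type*} {mα : MeasurableSpace α} {μ : Measure α} [IsFiniteMeasure μ]
    {p : ENNReal} (J : ℕ) {f : α → ℝ} (hf : MemLp f p μ) :
    MemLp (fun x => condMeanNorm J (f x)) p μ := by
  have hsub : MemLp (fun x => condMeanNorm J (f x) - condMeanNorm J 0) p μ :=
    (show LipschitzWith 1 fun t => condMeanNorm J t - condMeanNorm J 0 from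
      fun r s => by simpa using lipschitzWith_condMeanNorm J r s).comp_memLp (by simp) hf
  refine (hsub.add (memLp_const (condMeanNorm J 0))).ae_eq (.of_forall fun x => ?_)
  exact sub_add_cancel _ _

end CondMeanNorm

section CondMeanNormSeries

lemma integral_sq_integral_eq_integral_mul {α β : Type*} {mα : MeasurableSpace α}
    {mβ : MeasurableSpace β} {μ : Measure α} {ν : Measure β} [IsFiniteMeasure μ]
    [IsProbabilityMeasure ν] {f : α × β → ℝ} (hf : MemLp f 2 (μ.prod ν)) :
    ∫ x, (∫ y, f (x, y) ∂ν) ^ 2 ∂μ = ∫ q, f q.1 * f (q.1.1, q.2) ∂(μ.prod ν).prod ν := by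
  have hfst : MemLp (fun q : (α × β) × β => f q.1) 2 ((μ.prod ν).prod ν) :=
    hf.comp_measurePreserving measurePreserving_fst
  have hsnd : MemLp (fun q : (α × β) × β => f (q.1.1, q.2)) 2 ((μ.prod ν).prod ν) :=
    hf.comp_measurePreserving (measurePreserving_fst.prod (.id ν))
  have hmean : MemLp (fun p : α × β => ∫ z, f (p.1, z) ∂ν) 2 (μ.prod ν) :=
    (memLp_integral_prod_left hf).comp_measurePreserving measurePreserving_fst
  have hmul : Integrable (fun p : α × β => f p * ∫ z, f (p.1, z) ∂ν) (μ.prod ν) :=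
    hf.integrable_mul hmean
  have hprod : Integrable (fun q : (α × β) × β => f q.1 * f (q.1.1, q.2))
      ((μ.prod ν).prod ν) := hfst.integrable_mul hsnd
  rw [integral_prod _ hprod]
  simp_rw [integral_const_mul]
  rw [integral_prod _ hmul]
  simp_rw [integral_mul_const, sq]

section Moments

variable {E F : Type*} [NormedAddCommGroup E] [InnerProductSpace ℝ E] [FiniteDimensional ℝ E]
  [MeasurableSpace E] [BorelSpace E] [NormedAddCommGroup F] [InnerProductSpace ℝ F]
  [FiniteDimensional ℝ F] [MeasurableSpace F] [BorelSpace F]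

lemma integral_mul_comp_norm_of_homogeneous [Nontrivial E] {f : E → ℝ} {m : ℕ}
    (hf : ∀ (r : ℝ) (x : E), 0 < r → f (r • x) = r ^ m * f x) (ψ : ℝ → ℝ) :
    (∫ x, f x * ψ ‖x‖ ∂stdGaussian E) * ∫ x, ‖x‖ ^ m ∂stdGaussian E =
      (∫ x, f x ∂stdGaussian E) * ∫ x, ψ ‖x‖ * ‖x‖ ^ m ∂stdGaussian E := by
  have hangular (r : ℝ) (x : E) (hr : 0 < r) :
      f (r • x) / ‖r • x‖ ^ m = f x / ‖x‖ ^ m := by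
    rw [hf r x hr, norm_smul, Real.norm_of_nonneg hr.le, mul_pow,
      mul_div_mul_left _ _ (pow_ne_zero m hr.ne')]
  have hcancel (x : E) : f x / ‖x‖ ^ m * ‖x‖ ^ m = f x := by
    refine div_mul_cancel_of_imp fun hx => ?_
    obtain ⟨hx, hm⟩ := pow_eq_zero_iff'.1 hx
    have h := hf 2 0 two_pos
    rw [smul_zero] at h
    rw [norm_eq_zero.1 hx]
    nlinarith [one_lt_pow₀ (one_lt_two (α := ℝ)) hm]
  have hmean := integral_stdGaussian_angular_mul_radial (h := fun x => f x / ‖x‖ ^ m)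
    (fun r => r ^ m) hangular
  have hweighted := integral_stdGaussian_angular_mul_radial (h := fun x => f x / ‖x‖ ^ m)
    (fun r => ψ r * r ^ m) hangular
  simp only [hcancel, mul_left_comm _ (ψ _), mul_comm (ψ _) (f _)] at hmean hweighted
  rw [hmean, hweighted]
  ring

lemma integral_norm_mul_norm_snd_pow [Nontrivial (WithLp 2 (E × F))] (k : ℕ) :
    (∫ p, ‖p‖ * ‖p.snd‖ ^ (2 * k) ∂stdGaussian (WithLp 2 (E × F))) *
        (ascPochhammer ℝ k).eval ((Module.finrank ℝ (WithLp 2 (E × F)) : ℝ) / 2) =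
      (ascPochhammer ℝ k).eval ((Module.finrank ℝ F : ℝ) / 2) *
        ∫ p, ‖p‖ ^ (2 * k + 1) ∂stdGaussian (WithLp 2 (E × F)) := by
  have h := integral_mul_comp_norm_of_homogeneous (E := WithLp 2 (E × F))
    (f := fun p => ‖p.snd‖ ^ (2 * k)) (m := 2 * k) (fun r p hr => by
      rw [WithLp.smul_snd, norm_smul, Real.norm_of_nonneg hr.le, mul_pow]) id
  simp only [id, integral_stdGaussian_withLp_snd (E := E) fun y : F => ‖y‖ ^ (2 * k),
    integral_norm_pow_two_mul_stdGaussian, mul_comm (_ ^ (2 * k)) ‖_‖,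
    ← pow_succ'] at h
  have htwo : (2 : ℝ) ^ k ≠ 0 := by positivity
  exact mul_left_cancel₀ htwo (by linear_combination h)

lemma integral_norm_fst_mul_norm_mul_pow_mul_integral_norm_pow
    [Nontrivial (WithLp 2 (WithLp 2 (E × F) × F))] (k : ℕ) :
    (∫ v, ‖v.fst‖ * ‖v‖ * ((‖v.fst.snd‖ / ‖v‖) ^ 2) ^ k
        ∂stdGaussian (WithLp 2 (WithLp 2 (E × F) × F))) *
        ∫ v, ‖v‖ ^ (2 * k + 1) ∂stdGaussian (WithLp 2 (WithLp 2 (E × F) × F)) =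
      (∫ p, ‖p‖ * ‖p.snd‖ ^ (2 * k) ∂stdGaussian (WithLp 2 (E × F))) *
        Module.finrank ℝ (WithLp 2 (WithLp 2 (E × F) × F)) := by
  have hmarginal := integral_stdGaussian_withLp_fst (F := F)
    fun p : WithLp 2 (E × F) => ‖p‖ * ‖p.snd‖ ^ (2 * k)
  have hhomogeneous := integral_mul_comp_norm_of_homogeneous
    (E := WithLp 2 (WithLp 2 (E × F) × F)) (f := fun v => ‖v.fst‖ * ‖v.fst.snd‖ ^ (2 * k))
    (m := 2 * k + 1) (fun r v hr => by
      simp only [WithLp.smul_fst, WithLp.smul_snd, norm_smul, Real.norm_of_nonneg hr.le]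
      ring) (fun r => r / r ^ (2 * k))
  have hleft (v : WithLp 2 (WithLp 2 (E × F) × F)) :
      ‖v.fst‖ * ‖v.fst.snd‖ ^ (2 * k) * (‖v‖ / ‖v‖ ^ (2 * k)) =
        ‖v.fst‖ * ‖v‖ * ((‖v.fst.snd‖ / ‖v‖) ^ 2) ^ k := by
    rw [← pow_mul, div_pow]
    ring
  have hright (r : ℝ) : r / r ^ (2 * k) * r ^ (2 * k + 1) = r ^ 2 := by
    rcases eq_or_ne r 0 with rfl | hr
    · simp
    · rw [div_mul_eq_mul_div, pow_succ]
      field_simp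
  simpa only [hleft, hright, hmarginal, integral_norm_sq_stdGaussian] using hhomogeneous

lemma integral_norm_fst_mul_norm_mul_pow [Nontrivial (WithLp 2 (E × F))] (k : ℕ) :
    ∫ v, ‖v.fst‖ * ‖v‖ * ((‖v.fst.snd‖ / ‖v‖) ^ 2) ^ k
        ∂stdGaussian (WithLp 2 (WithLp 2 (E × F) × F)) =
      Module.finrank ℝ (WithLp 2 (WithLp 2 (E × F) × F)) *
        ((∫ p, ‖p‖ ∂stdGaussian (WithLp 2 (E × F))) /
          ∫ v, ‖v‖ ∂stdGaussian (WithLp 2 (WithLp 2 (E × F) × F))) *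
      ((ascPochhammer ℝ k).eval (((Module.finrank ℝ (WithLp 2 (E × F)) : ℝ) + 1) / 2) *
        (ascPochhammer ℝ k).eval ((Module.finrank ℝ F : ℝ) / 2) /
          ((ascPochhammer ℝ k).eval
              (((Module.finrank ℝ (WithLp 2 (WithLp 2 (E × F) × F)) : ℝ) + 1) / 2) *
            (ascPochhammer ℝ k).eval ((Module.finrank ℝ (WithLp 2 (E × F)) : ℝ) / 2))) := by
  have hV : Nontrivial (WithLp 2 (WithLp 2 (E × F) × F)) := (WithLp.toLp_injective 2).nontrivial
  have hhomogeneous := integral_norm_fst_mul_norm_mul_pow_mul_integral_norm_pow (E := E) (F := F) k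
  have hmixed := integral_norm_mul_norm_snd_pow (E := E) (F := F) k
  simp only [integral_norm_pow_two_mul_add_one_stdGaussian] at hhomogeneous hmixed
  have hmean := integral_norm_stdGaussian_pos (WithLp 2 (WithLp 2 (E × F) × F))
  have hpochhammer {a : ℝ} (ha : 0 < a) := ascPochhammer_pos k a ha
  have hW : 0 < (Module.finrank ℝ (WithLp 2 (E × F)) : ℝ) := Nat.cast_pos.2 Module.finrank_pos
  have hlow := hpochhammer (half_pos hW)
  have hhigh := hpochhammer (show
    0 < ((Module.finrank ℝ (WithLp 2 (WithLp 2 (E × F) × F)) : ℝ) + 1) / 2 by positivity)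
  rw [mul_div_assoc' (Module.finrank ℝ (WithLp 2 (WithLp 2 (E × F) × F)) : ℝ),
    div_mul_div_comm, eq_div_iff (by positivity)]
  have htwo : (2 : ℝ) ^ k ≠ 0 := by positivity
  exact mul_left_cancel₀ htwo (by
    linear_combination (ascPochhammer ℝ k).eval
      ((Module.finrank ℝ (WithLp 2 (E × F)) : ℝ) / 2) * hhomogeneous +
        Module.finrank ℝ (WithLp 2 (WithLp 2 (E × F) × F)) * hmixed)

end Moments

end CondMeanNormSeries

lemma hasSum_sqrtCoeff_mul_integral {α : Type*} {mα : MeasurableSpace α} {μ : Measure α}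
    {g u : α → ℝ} (hg : Integrable g μ) (hu : AEStronglyMeasurable u μ) (hu0 : ∀ x, 0 ≤ u x)
    (hu1 : ∀ x, u x ≤ 1) :
    HasSum (fun k => sqrtCoeff k * ∫ x, g x * u x ^ k ∂μ) (∫ x, g x * √(1 - u x) ∂μ) := by
  have hbound (k : ℕ) (x : α) : ‖sqrtCoeff k * (g x * u x ^ k)‖ ≤ |sqrtCoeff k| * ‖g x‖ := by
    rw [norm_mul, norm_mul, Real.norm_eq_abs (sqrtCoeff k),
      Real.norm_of_nonneg (pow_nonneg (hu0 x) k)]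
    gcongr
    exact mul_le_of_le_one_right (norm_nonneg _) (pow_le_one₀ (hu0 x) (hu1 x))
  have hint (k : ℕ) : Integrable (fun x => sqrtCoeff k * (g x * u x ^ k)) μ :=
    (hg.norm.const_mul |sqrtCoeff k|).mono' ((hg.1.mul (hu.pow k)).const_mul _)
      (.of_forall (hbound k))
  have hsummable : Summable fun k => ∫ x, ‖sqrtCoeff k * (g x * u x ^ k)‖ ∂μ := by
    refine Summable.of_nonneg_of_le (fun k => integral_nonneg fun x => norm_nonneg _) (fun k => ?_)
      (summable_abs_sqrtCoeff.mul_right (∫ x, ‖g x‖ ∂μ))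
    rw [← integral_const_mul]
    exact integral_mono (hint k).norm (hg.norm.const_mul _) (hbound k)
  have hpointwise (x : α) : ∑' k, sqrtCoeff k * (g x * u x ^ k) = g x * √(1 - u x) := by
    simp_rw [mul_left_comm _ (g x)]
    exact ((hasSum_sqrtCoeff (hu0 x) (hu1 x)).mul_left (g x)).tsum_eq
  simpa only [hpointwise, integral_const_mul] using
    hasSum_integral_of_summable_integral_norm hint hsummable

section CondMeanNormSq

variable (E F : Type*) [NormedAddCommGroup E] [InnerProductSpace ℝ E] [FiniteDimensional ℝ E]
  [MeasurableSpace E] [BorelSpace E] [NormedAddCommGroup F] [InnerProductSpace ℝ F]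
  [FiniteDimensional ℝ F] [MeasurableSpace F] [BorelSpace F]

lemma condMeanNormSq_finrank :
    condMeanNormSq (Module.finrank ℝ E) (Module.finrank ℝ F) =
      ∫ v, ‖v.fst‖ * √(‖v‖ ^ 2 - ‖v.fst.snd‖ ^ 2)
        ∂stdGaussian (WithLp 2 (WithLp 2 (E × F) × F)) := by
  have hnorm : MemLp (fun p : E × F => √(‖p.1‖ ^ 2 + ‖p.2‖ ^ 2)) 2
      ((stdGaussian E).prod (stdGaussian F)) :=
    memLp_sqrt_add_sq
      ((memLp_norm_stdGaussian ENNReal.ofNat_ne_top).comp_measurePreserving measurePreserving_fst)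
      ((memLp_norm_stdGaussian ENNReal.ofNat_ne_top).comp_measurePreserving measurePreserving_snd)
  have hpair : MeasurePreserving
      (WithLp.toLp 2 ∘ Prod.map (WithLp.toLp 2) id : (E × F) × F → WithLp 2 (WithLp 2 (E × F) × F))
      (((stdGaussian E).prod (stdGaussian F)).prod (stdGaussian F)) (stdGaussian _) :=
    measurePreserving_toLp_stdGaussian.comp (measurePreserving_toLp_stdGaussian.prod (.id _))
  rw [condMeanNormSq_finrank_left, ← hpair.map_eq, integral_map hpair.aemeasurable
    (Measurable.aestronglyMeasurable (by fun_prop))]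
  simp_rw [condMeanNorm_finrank]
  rw [integral_sq_integral_eq_integral_mul hnorm]
  refine integral_congr_ae (.of_forall fun q => ?_)
  rcases q with ⟨⟨x, y⟩, z⟩
  simp only [Function.comp_apply, Prod.map_apply, id, WithLp.prod_norm_sq_eq_of_L2]
  rw [WithLp.prod_norm_eq_of_L2 (WithLp.fst _), add_sub_right_comm, add_sub_cancel_right]
  rfl

lemma hasSum_condMeanNormSq_finrank :
    HasSum (fun k => sqrtCoeff k * ∫ v, ‖v.fst‖ * ‖v‖ * ((‖v.fst.snd‖ / ‖v‖) ^ 2) ^ k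
        ∂stdGaussian (WithLp 2 (WithLp 2 (E × F) × F)))
      (condMeanNormSq (Module.finrank ℝ E) (Module.finrank ℝ F)) := by
  have hfst_snd (v : WithLp 2 (WithLp 2 (E × F) × F)) : ‖v.fst.snd‖ ≤ ‖v‖ :=
    (WithLp.norm_snd_le _ v.fst).trans (WithLp.norm_fst_le _ v)
  have hint : Integrable (fun v : WithLp 2 (WithLp 2 (E × F) × F) => ‖v.fst‖ * ‖v‖)
      (stdGaussian _) := by
    have hnorm := memLp_norm_stdGaussian (E := WithLp 2 (WithLp 2 (E × F) × F)) (p := 2)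
      ENNReal.ofNat_ne_top
    refine hnorm.integrable_sq.mono' (by fun_prop) (.of_forall fun v => ?_)
    rw [norm_mul, norm_norm, norm_norm, sq]
    gcongr
    exact WithLp.norm_fst_le _ v
  have hseries := hasSum_sqrtCoeff_mul_integral hint
    (u := fun v => (‖v.fst.snd‖ / ‖v‖) ^ 2) (Measurable.aestronglyMeasurable (by fun_prop))
    (fun v => sq_nonneg _)
    (fun v => pow_le_one₀ (by positivity) (div_le_one_of_le₀ (hfst_snd v) (norm_nonneg _)))
  have hsqrt (v : WithLp 2 (WithLp 2 (E × F) × F)) :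
      ‖v‖ * √(1 - (‖v.fst.snd‖ / ‖v‖) ^ 2) = √(‖v‖ ^ 2 - ‖v.fst.snd‖ ^ 2) := by
    rw [div_pow]
    nth_rewrite 1 [← Real.sqrt_sq (norm_nonneg v)]
    rw [← Real.sqrt_mul (sq_nonneg _), mul_sub, mul_one, mul_div_cancel_of_imp']
    exact fun hv => pow_eq_zero_iff two_ne_zero |>.2 (le_antisymm
      ((hfst_snd v).trans_eq (pow_eq_zero_iff two_ne_zero |>.1 hv)) (norm_nonneg _))
  rw [condMeanNormSq_finrank]
  simpa only [mul_assoc, hsqrt] using hseries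

end CondMeanNormSq

lemma beta_div_beta_of_add_eq_add {a b c d : ℝ} (h : a + b = c + d) (hab : 0 < a + b) :
    beta a b / beta c d = Real.Gamma a * Real.Gamma b / (Real.Gamma c * Real.Gamma d) := by
  rw [beta, beta, h, div_div_div_cancel_right₀ (Real.Gamma_pos_of_pos (h ▸ hab)).ne']

lemma hasSum_condMeanNormSq {n K J : ℕ} (hn : 0 < n) (h : K + J = n) :
    HasSum (fun k => ((n : ℝ) + J) *
      (beta (((n : ℝ) + J) / 2) (((n : ℝ) + 1) / 2) / beta (((n : ℝ) + J + 1) / 2) ((n : ℝ) / 2)) *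
      hypergeometricTerm [((n : ℝ) + 1) / 2, (J : ℝ) / 2, -(1 / 2)]
        [((n : ℝ) + J + 1) / 2, (n : ℝ) / 2] 1 k) (condMeanNormSq K J) := by
  let W := WithLp 2 (EuclideanSpace ℝ (Fin K) × EuclideanSpace ℝ (Fin J))
  let V := WithLp 2 (W × EuclideanSpace ℝ (Fin J))
  have hW : Module.finrank ℝ W = n := by
    simpa [W, h] using (WithLp.linearEquiv 2 ℝ
      (EuclideanSpace ℝ (Fin K) × EuclideanSpace ℝ (Fin J))).finrank_eq
  have hV : Module.finrank ℝ V = n + J := by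
    simpa [V, hW] using (WithLp.linearEquiv 2 ℝ (W × EuclideanSpace ℝ (Fin J))).finrank_eq
  have : Nontrivial W := Module.nontrivial_of_finrank_pos (R := ℝ) (hW ▸ hn)
  have : Nontrivial V := (WithLp.toLp_injective 2).nontrivial
  have : (0 : ℝ) < n := Nat.cast_pos.2 hn
  have hratio : (∫ w, ‖w‖ ∂stdGaussian W) / ∫ v, ‖v‖ ∂stdGaussian V =
      beta (((n : ℝ) + J) / 2) (((n : ℝ) + 1) / 2) /
        beta (((n : ℝ) + J + 1) / 2) ((n : ℝ) / 2) := by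
    rw [beta_div_beta_of_add_eq_add (by ring) (by positivity), integral_norm_stdGaussian,
      integral_norm_stdGaussian, hW, hV, mul_div_mul_left _ _ (by positivity : √(2 : ℝ) ≠ 0)]
    push_cast
    field_simp
  have hseries :=
    hasSum_condMeanNormSq_finrank (EuclideanSpace ℝ (Fin K)) (EuclideanSpace ℝ (Fin J))
  simp only [integral_norm_fst_mul_norm_mul_pow, finrank_euclideanSpace_fin, hratio, hW, hV,
    W, V, Nat.cast_add] at hseries
  convert! hseries using 2 with k
  simp only [hypergeometricTerm, sqrtCoeff, List.map_cons, List.map_nil, List.prod_cons,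
    List.prod_nil, one_pow, mul_one]
  ring

section NoisyProjection

variable {E : Type*} [NormedAddCommGroup E] [InnerProductSpace ℝ E]

lemma norm_add_sq_of_mem_orthogonal {U : Submodule ℝ E} {x y : E} (hx : x ∈ U) (hy : y ∈ Uᗮ) :
    ‖x + y‖ ^ 2 = ‖x‖ ^ 2 + ‖y‖ ^ 2 := by
  simpa only [sq] using norm_add_sq_eq_norm_sq_add_norm_sq_real
    (U.inner_right_of_mem_orthogonal hx hy)

variable [FiniteDimensional ℝ E] (U : Submodule ℝ E)

lemma norm_sub_comp_starProjection_add (v : E → ℝ) (p : U × Uᗮ) :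
    ‖(p.1 + p.2 : E)‖ - v (U.starProjection (p.1 + p.2)) =
      √(‖p.1‖ ^ 2 + ‖p.2‖ ^ 2) - v p.1 := by
  rw [map_add, Submodule.starProjection_eq_self_iff.2 p.1.2,
    (Submodule.starProjection_apply_eq_zero_iff U).2 p.2.2, add_zero, U.coe_norm, Uᗮ.coe_norm,
    ← norm_add_sq_of_mem_orthogonal p.1.2 p.2.2, Real.sqrt_sq (norm_nonneg _)]

lemma abs_norm_sub_norm_rotation_starProjection_le {s c : ℝ} (hs : s ≤ 1) (hc : 0 ≤ c)
    (x z : E) :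
    |‖x‖ - ‖U.starProjection (s • x - c • z) + (x - U.starProjection x)‖| ≤
      (1 - s) * ‖x‖ + c * ‖z‖ := by
  have hdiff : x - (U.starProjection (s • x - c • z) + (x - U.starProjection x)) =
      U.starProjection ((1 - s) • x + c • z) := by
    simp only [map_sub, map_add, map_smul]
    module
  refine (abs_norm_sub_norm_le _ _).trans (hdiff ▸ (U.norm_starProjection_apply_le _).trans ?_)
  refine (norm_add_le _ _).trans_eq ?_
  rw [norm_smul, norm_smul, Real.norm_of_nonneg (sub_nonneg.2 hs), Real.norm_of_nonneg hc]

lemma smul_starProjection_rotation {c : ℝ} (hc : c ≠ 0) (s : ℝ) (x z : E) :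
    c⁻¹ • U.starProjection (U.starProjection (c • x + s • z) + (z - U.starProjection z)) +
        (s / c) • (U.starProjection (c • x + s • z) + (z - U.starProjection z) -
          U.starProjection (U.starProjection (c • x + s • z) + (z - U.starProjection z))) =
      U.starProjection x + (s / c) • z := by
  have hproj : U.starProjection (U.starProjection (c • x + s • z) +
      (z - U.starProjection z)) = U.starProjection (c • x + s • z) := by
    rw [map_add, Submodule.starProjection_eq_self_iff.2 (U.starProjection_apply_mem _),
      (Submodule.starProjection_apply_eq_zero_iff U).2 (U.sub_starProjection_mem_orthogonal z),
      add_zero]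
  rw [hproj, add_sub_cancel_left, map_add, map_smul, map_smul, smul_add, inv_smul_smul₀ hc,
    smul_smul, inv_mul_eq_div]
  module

variable [MeasurableSpace E] [BorelSpace E]

lemma integral_sqrt_add_sq_sub_sq :
    ∫ p : U × Uᗮ, √(‖p.1‖ ^ 2 + ‖p.2‖ ^ 2) ^ 2 ∂(stdGaussian U).prod (stdGaussian Uᗮ) -
        ∫ x, (∫ y, √(‖x‖ ^ 2 + ‖y‖ ^ 2) ∂stdGaussian Uᗮ) ^ 2 ∂stdGaussian U =
      Module.finrank ℝ E - condMeanNormSq (Module.finrank ℝ U) (Module.finrank ℝ Uᗮ) := by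
  have hadd := measurePreserving_add_stdGaussian U
  rw [condMeanNormSq_finrank_left U, ← integral_norm_sq_stdGaussian E, ← hadd.map_eq,
    integral_map hadd.aemeasurable (Measurable.aestronglyMeasurable (by fun_prop))]
  simp_rw [condMeanNorm_finrank, norm_add_sq_of_mem_orthogonal (Subtype.coe_prop _)
    (Subtype.coe_prop _), Real.sq_sqrt (add_nonneg (sq_nonneg _) (sq_nonneg _)),
    Submodule.coe_norm]

lemma memLp_sqrt_norm_add_sq :
    MemLp (fun p : U × Uᗮ => √(‖p.1‖ ^ 2 + ‖p.2‖ ^ 2)) 2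
      ((stdGaussian U).prod (stdGaussian Uᗮ)) :=
  memLp_sqrt_add_sq
    ((memLp_norm_stdGaussian ENNReal.ofNat_ne_top).comp_measurePreserving measurePreserving_fst)
    ((memLp_norm_stdGaussian ENNReal.ofNat_ne_top).comp_measurePreserving measurePreserving_snd)

lemma integral_norm_sub_condMeanNorm_starProjection_sq :
    ∫ x, (‖x‖ - condMeanNorm (Module.finrank ℝ Uᗮ) ‖U.starProjection x‖) ^ 2 ∂stdGaussian E =
      Module.finrank ℝ E - condMeanNormSq (Module.finrank ℝ U) (Module.finrank ℝ Uᗮ) := by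
  have hadd := measurePreserving_add_stdGaussian U
  have hmeas : Measurable (condMeanNorm (Module.finrank ℝ Uᗮ)) :=
    (continuous_condMeanNorm _).measurable
  rw [← hadd.map_eq,
    integral_map hadd.aemeasurable (Measurable.aestronglyMeasurable (by fun_prop))]
  simp_rw [norm_sub_comp_starProjection_add U fun x => condMeanNorm (Module.finrank ℝ Uᗮ) ‖x‖,
    ← integral_sqrt_add_sq_sub_sq, ← integral_sub_integral_prod_sq (memLp_sqrt_norm_add_sq U),
    condMeanNorm_finrank Uᗮ, Submodule.coe_norm]

lemma sub_condMeanNormSq_le_integral_starProjection {v : E → ℝ}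
    (hv : Integrable (fun x => (‖x‖ - v (U.starProjection x)) ^ 2) (stdGaussian E)) :
    Module.finrank ℝ E - condMeanNormSq (Module.finrank ℝ U) (Module.finrank ℝ Uᗮ) ≤
      ∫ x, (‖x‖ - v (U.starProjection x)) ^ 2 ∂stdGaussian E := by
  have hadd := measurePreserving_add_stdGaussian U
  have hcomp := hadd.integrable_comp_of_integrable hv
  rw [← integral_sqrt_add_sq_sub_sq, ← hadd.map_eq, integral_map hadd.aemeasurable
    (hadd.map_eq.symm ▸ hv.1)]
  simp only [Function.comp_def, norm_sub_comp_starProjection_add] at hcomp ⊢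
  exact integral_sq_sub_le_integral_sub_comp_fst_sq (memLp_sqrt_norm_add_sq U)
    (v := fun x => v x) hcomp

lemma sub_condMeanNormSq_le_integral_starProjection_add {β : Type*} {mβ : MeasurableSpace β}
    {ρ : Measure β} [IsProbabilityMeasure ρ] {v : E → ℝ} {g : β → E}
    (hv : Integrable (fun p => (‖p.1‖ - v (U.starProjection p.1 + g p.2)) ^ 2)
      ((stdGaussian E).prod ρ)) :
    Module.finrank ℝ E - condMeanNormSq (Module.finrank ℝ U) (Module.finrank ℝ Uᗮ) ≤
      ∫ p, (‖p.1‖ - v (U.starProjection p.1 + g p.2)) ^ 2 ∂(stdGaussian E).prod ρ := by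
  rw [integral_prod_symm _ hv]
  calc _ = ∫ _, (Module.finrank ℝ E -
        condMeanNormSq (Module.finrank ℝ U) (Module.finrank ℝ Uᗮ) : ℝ) ∂ρ := by simp
    _ ≤ _ := by
      refine integral_mono_ae (integrable_const _) hv.integral_prod_right ?_
      filter_upwards [hv.prod_left_ae] with z hz
      exact sub_condMeanNormSq_le_integral_starProjection U (v := fun x => v (x + g z)) hz

lemma variance_le_integral_comp_snd_sub_comp_fst_sq {α β : Type*} {mα : MeasurableSpace α}
    {mβ : MeasurableSpace β} {μ : Measure α} {ν : Measure β} [IsProbabilityMeasure μ]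
    [IsProbabilityMeasure ν] {g : β → ℝ} (hg : MemLp g 2 ν) {v : α → ℝ}
    (hv : Integrable (fun p => (g p.2 - v p.1) ^ 2) (μ.prod ν)) :
    Var[g; ν] ≤ ∫ p, (g p.2 - v p.1) ^ 2 ∂μ.prod ν := by
  have h := integral_sq_sub_le_integral_sub_comp_fst_sq
    (hg.comp_measurePreserving (measurePreserving_snd (μ := μ))) hv
  rw [variance_eq_sub hg]
  simpa [Function.comp_def, integral_fun_snd fun x => g x ^ 2] using h

lemma lpNorm_comp_measurePreserving {α β : Type*} {mα : MeasurableSpace α}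
    {mβ : MeasurableSpace β} {μ : Measure α} {ν : Measure β} {T : α → β}
    (hT : MeasurePreserving T μ ν) {f : β → ℝ} (hf : AEStronglyMeasurable f ν) (p : ENNReal) :
    lpNorm (fun x => f (T x)) p μ = lpNorm f p ν := by
  rw [← toReal_eLpNorm hf, ← eLpNorm_comp_measurePreserving hf hT]
  exact (toReal_eLpNorm (hf.comp_measurePreserving hT)).symm

lemma sqrt_variance_le_lpNorm_snd_sub_fst {α β : Type*} {mα : MeasurableSpace α}
    {mβ : MeasurableSpace β} {μ : Measure α} {ν : Measure β} [IsProbabilityMeasure μ]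
    [IsProbabilityMeasure ν] {g : β → ℝ} (hg : MemLp g 2 ν) {v : α → ℝ}
    (hv : MemLp (fun p => g p.2 - v p.1) 2 (μ.prod ν)) :
    √Var[g; ν] ≤ lpNorm (fun p => g p.2 - v p.1) 2 (μ.prod ν) := by
  refine (Real.sqrt_le_left lpNorm_nonneg).2 ?_
  rw [sq_lpNorm_two hv.1]
  exact variance_le_integral_comp_snd_sub_comp_fst_sq hg hv.integrable_sq

lemma measurePreserving_rotation_starProjection {s c : ℝ} (hsc : s ^ 2 + c ^ 2 = 1) :
    MeasurePreserving (fun p : E × E =>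
        (U.starProjection (c • p.1 + s • p.2) + (p.2 - U.starProjection p.2),
          U.starProjection (s • p.1 - c • p.2) + (p.1 - U.starProjection p.1)))
      ((stdGaussian E).prod (stdGaussian E)) ((stdGaussian E).prod (stdGaussian E)) := by
  let A := U.starProjection.toLinearMap
  let fst := LinearMap.fst ℝ E E
  let snd := LinearMap.snd ℝ E E
  refine measurePreserving_prod_stdGaussian_of_norm_sq
    ((A ∘ₗ (c • fst + s • snd) + (snd - A ∘ₗ snd)).prod
      (A ∘ₗ (s • fst - c • snd) + (fst - A ∘ₗ fst))) fun p => ?_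
  have hpythagoras (x y : E) : ‖A x + (y - A y)‖ ^ 2 = ‖A x‖ ^ 2 + ‖y - A y‖ ^ 2 :=
    norm_add_sq_of_mem_orthogonal (U.starProjection_apply_mem x)
      (U.sub_starProjection_mem_orthogonal y)
  have hsplit (x : E) : ‖x‖ ^ 2 = ‖A x‖ ^ 2 + ‖x - A x‖ ^ 2 := by
    rw [← hpythagoras, add_sub_cancel]
  have hrotation : ‖A (c • p.1 + s • p.2)‖ ^ 2 + ‖A (s • p.1 - c • p.2)‖ ^ 2 =
      ‖A p.1‖ ^ 2 + ‖A p.2‖ ^ 2 := by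
    simp only [map_add, map_sub, map_smul, norm_add_sq_real, norm_sub_sq_real, norm_smul,
      real_inner_smul_left, real_inner_smul_right, mul_pow, Real.norm_eq_abs, sq_abs]
    linear_combination (‖A p.1‖ ^ 2 + ‖A p.2‖ ^ 2) * hsc
  change ‖A (c • p.1 + s • p.2) + (p.2 - A p.2)‖ ^ 2 +
    ‖A (s • p.1 - c • p.2) + (p.1 - A p.1)‖ ^ 2 = _
  rw [hpythagoras, hpythagoras, hsplit p.1, hsplit p.2]
  linear_combination hrotation

lemma lpNorm_norm_stdGaussian : lpNorm (fun x : E => ‖x‖) 2 (stdGaussian E) =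
    √(Module.finrank ℝ E) := by
  rw [← integral_norm_sq_stdGaussian E, ← sq_lpNorm_two (by fun_prop), Real.sqrt_sq lpNorm_nonneg]

lemma memLp_norm_sub_norm_rotation_starProjection {s c : ℝ} (hsc : s ^ 2 + c ^ 2 = 1) :
    MemLp (fun p : E × E =>
        ‖p.1‖ - ‖U.starProjection (s • p.1 - c • p.2) + (p.1 - U.starProjection p.1)‖) 2
      ((stdGaussian E).prod (stdGaussian E)) :=
  have hnorm := memLp_norm_stdGaussian (E := E) (ENNReal.ofNat_ne_top (n := 2))
  (hnorm.comp_measurePreserving measurePreserving_fst).sub <| hnorm.comp_measurePreserving <|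
    measurePreserving_snd.comp (measurePreserving_rotation_starProjection U hsc)

lemma lpNorm_norm_sub_norm_rotation_starProjection_le {s c : ℝ} (hs : s ≤ 1) (hc : 0 ≤ c) :
    lpNorm (fun p : E × E =>
        ‖p.1‖ - ‖U.starProjection (s • p.1 - c • p.2) + (p.1 - U.starProjection p.1)‖) 2
      ((stdGaussian E).prod (stdGaussian E)) ≤
      (1 - s) * √(Module.finrank ℝ E) + c * √(Module.finrank ℝ E) := by
  have hnorm := memLp_norm_stdGaussian (E := E) (ENNReal.ofNat_ne_top (n := 2))
  have hfst := (hnorm.comp_measurePreserving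
    (measurePreserving_fst (ν := stdGaussian E))).const_smul (1 - s)
  have hsnd := (hnorm.comp_measurePreserving
    (measurePreserving_snd (μ := stdGaussian E))).const_smul c
  refine (lpNorm_mono_real (hfst.add hsnd) fun p =>
    abs_norm_sub_norm_rotation_starProjection_le U hs hc p.1 p.2).trans ?_
  refine (lpNorm_add_le hfst one_le_two).trans_eq ?_
  rw [lpNorm_const_smul, lpNorm_const_smul, coe_nnnorm, coe_nnnorm,
    Real.norm_of_nonneg (sub_nonneg.2 hs), Real.norm_of_nonneg hc,
    ← lpNorm_norm_stdGaussian (E := E)]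
  congr 2
  · exact lpNorm_comp_measurePreserving measurePreserving_fst hnorm.1 2
  · exact lpNorm_comp_measurePreserving measurePreserving_snd hnorm.1 2

lemma sqrt_variance_sub_le_lpNorm {s c : ℝ} (hsc : s ^ 2 + c ^ 2 = 1) (hs : s ≤ 1) (hc : 0 < c)
    {v : E → ℝ} (hv : Measurable v)
    (hint : MemLp (fun p => ‖p.1‖ - v (U.starProjection p.1 + (s / c) • p.2)) 2
      ((stdGaussian E).prod (stdGaussian E))) :
    √Var[fun x => ‖x‖; stdGaussian E] -
        ((1 - s) * √(Module.finrank ℝ E) + c * √(Module.finrank ℝ E)) ≤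
      lpNorm (fun p => ‖p.1‖ - v (U.starProjection p.1 + (s / c) • p.2)) 2
        ((stdGaussian E).prod (stdGaussian E)) := by
  let T (p : E × E) : E × E :=
    (U.starProjection (c • p.1 + s • p.2) + (p.2 - U.starProjection p.2),
      U.starProjection (s • p.1 - c • p.2) + (p.1 - U.starProjection p.1))
  have hT : MeasurePreserving T _ _ := measurePreserving_rotation_starProjection U hsc
  -- The measurement is a function `w` of the first component of the rotated pair, which is
  -- independent of the second component, and the latter is close to the input.
  let w (t : E) : E := c⁻¹ • U.starProjection t + (s / c) • (t - U.starProjection t)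
  have hmeas : Measurable fun p : E × E => ‖p.2‖ - v (w p.1) := by fun_prop
  let measurementError (p : E × E) : ℝ := ‖p.1‖ - v (U.starProjection p.1 + (s / c) • p.2)
  let rotationError (p : E × E) : ℝ :=
    ‖p.1‖ - ‖U.starProjection (s • p.1 - c • p.2) + (p.1 - U.starProjection p.1)‖
  have hcomp : (fun p : E × E => ‖p.2‖ - v (w p.1)) ∘ T = measurementError - rotationError := by
    ext p
    simp only [Function.comp_apply, Pi.sub_apply, T, w, measurementError, rotationError,
      smul_starProjection_rotation U hc.ne', sub_sub_sub_cancel_left]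
  have hrot : MemLp rotationError 2 _ := memLp_norm_sub_norm_rotation_starProjection U hsc
  have hmem : MemLp (fun p : E × E => ‖p.2‖ - v (w p.1)) 2
      ((stdGaussian E).prod (stdGaussian E)) := by
    rw [← hT.map_eq, memLp_map_measure_iff hmeas.aestronglyMeasurable hT.aemeasurable, hcomp]
    exact hint.sub hrot
  rw [sub_le_iff_le_add]
  calc _ ≤ lpNorm (fun p : E × E => ‖p.2‖ - v (w p.1)) 2 ((stdGaussian E).prod (stdGaussian E)) :=
        sqrt_variance_le_lpNorm_snd_sub_fst (v := fun t => v (w t))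
          (memLp_norm_stdGaussian ENNReal.ofNat_ne_top) hmem
    _ = lpNorm (measurementError - rotationError) 2 ((stdGaussian E).prod (stdGaussian E)) := by
        rw [← hcomp, ← lpNorm_comp_measurePreserving hT hmem.1, Function.comp_def]
    _ ≤ lpNorm measurementError 2 ((stdGaussian E).prod (stdGaussian E)) +
          lpNorm rotationError 2 ((stdGaussian E).prod (stdGaussian E)) :=
        lpNorm_sub_le hint one_le_two
    _ ≤ _ := by
        gcongr
        exact lpNorm_norm_sub_norm_rotation_starProjection_le U hs hc.le

end NoisyProjection

lemma measurable_clm_apply {α E F : Type*} [MeasurableSpace α] [NormedAddCommGroup E]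
    [NormedSpace ℝ E] [MeasurableSpace E] [BorelSpace E] [SecondCountableTopology E]
    [NormedAddCommGroup F] [NormedSpace ℝ F] [MeasurableSpace F] [BorelSpace F]
    {f : α → E →L[ℝ] F} {g : α → E} (hf : Measurable f) (hg : Measurable g) :
    Measurable fun a => f a (g a) :=
  isBoundedBilinearMap_apply.continuous.measurable.comp (hf.prodMk hg)

/-- The measurement model `Y = B X + N` in a Euclidean space `E`, in which `X` is standard
Gaussian, `N` is `σ` times a standard Gaussian vector, and `B` is a random orthogonal projection;
`X` and `N` are independent, and `B` is independent of `(X, N)`. The random projection need not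
be diagonal in a fixed basis and its law is arbitrary. -/
structure ProjectionModel (E : Type*) [NormedAddCommGroup E] [InnerProductSpace ℝ E]
    [FiniteDimensional ℝ E] [MeasurableSpace E] [BorelSpace E] (σ : ℝ) where
  Ω : Type u
  [measurableSpace : MeasurableSpace Ω]
  P : Measure Ω
  [isProbabilityMeasure : IsProbabilityMeasure P]
  X : Ω → E
  N : Ω → E
  B : Ω → E →L[ℝ] E
  measurable_X : Measurable X
  measurable_N : Measurable N
  measurable_B : Measurable B
  isStarProjection_B : ∀ ω, IsStarProjection (B ω)
  law_X : P.map X = stdGaussian E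
  law_N : P.map N = (stdGaussian E).map fun x => σ • x
  indep_X_N : IndepFun X N P
  indep_B_XN : IndepFun B (fun ω => (X ω, N ω)) P

namespace ProjectionModel

attribute [instance] ProjectionModel.measurableSpace ProjectionModel.isProbabilityMeasure

variable {E : Type*} [NormedAddCommGroup E] [InnerProductSpace ℝ E] [FiniteDimensional ℝ E]
  [MeasurableSpace E] [BorelSpace E] {σ : ℝ} (M : ProjectionModel.{u} E σ)

/-- The measurement `Y = B X + N`. -/
def Y (ω : M.Ω) : E :=
  M.B ω (M.X ω) + M.N ω

/-- The MMSE estimator `E[‖X‖ | Y]` of the norm of the input. -/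
noncomputable def estimator : M.Ω → ℝ :=
  M.P[fun ω => ‖M.X ω‖ | MeasurableSpace.comap M.Y inferInstance]

/-- The mean square error `E[(‖X‖ - E[‖X‖ | Y])²]` of the MMSE estimator. -/
noncomputable def mmse : ℝ :=
  ∫ ω, (‖M.X ω‖ - M.estimator ω) ^ 2 ∂M.P

lemma mmse_nonneg : 0 ≤ M.mmse := integral_nonneg fun _ => sq_nonneg _

lemma measurable_B_X : Measurable fun ω => M.B ω (M.X ω) :=
  measurable_clm_apply M.measurable_B M.measurable_X

lemma measurable_Y : Measurable M.Y :=
  M.measurable_B_X.add M.measurable_N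

lemma memLp_norm_X : MemLp (fun ω => ‖M.X ω‖) 2 M.P :=
  (memLp_norm_stdGaussian ENNReal.ofNat_ne_top).comp_measurePreserving
    ⟨M.measurable_X, M.law_X⟩

lemma exists_B_eq_starProjection (ω : M.Ω) :
    ∃ U : Submodule ℝ E, M.B ω = U.starProjection ∧
      Module.finrank ℝ U = Module.finrank ℝ (M.B ω).range :=
  have ⟨_, h⟩ := isStarProjection_iff_eq_starProjection_range.1
    (M.isStarProjection_B ω)
  ⟨(M.B ω).range, h, rfl⟩

lemma norm_B_apply_le (ω : M.Ω) (x : E) : ‖M.B ω x‖ ≤ ‖x‖ := by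
  obtain ⟨U, hU, -⟩ := M.exists_B_eq_starProjection ω
  exact hU ▸ U.norm_starProjection_apply_le x

lemma identDistrib_B_X_N :
    IdentDistrib (fun ω => (M.B ω, M.X ω, M.N ω))
      (fun q : M.Ω × E × E => (M.B q.1, q.2.1, σ • q.2.2)) M.P
      (M.P.prod ((stdGaussian E).prod (stdGaussian E))) where
  aemeasurable_fst :=
    (M.measurable_B.prodMk (M.measurable_X.prodMk M.measurable_N)).aemeasurable
  aemeasurable_snd :=
    ((M.measurable_B.comp measurable_fst).prodMk (by fun_prop)).aemeasurable
  map_eq := by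
    have hX := M.measurable_X.aemeasurable (μ := M.P)
    have hN := M.measurable_N.aemeasurable (μ := M.P)
    rw [(indepFun_iff_map_prod_eq_prod_map_map M.measurable_B.aemeasurable
        (hX.prodMk hN)).1 M.indep_B_XN, (indepFun_iff_map_prod_eq_prod_map_map hX hN).1 M.indep_X_N,
      M.law_X, M.law_N, ← Measure.map_id (μ := stdGaussian E), Measure.map_map (by fun_prop)
      measurable_id, Measure.map_prod_map _ _ (by fun_prop) (by fun_prop),
      Measure.map_prod_map _ _ M.measurable_B (by fun_prop)]
    simp only [Measure.map_id]
    rfl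

lemma mmse_le {v : E → ℝ} (hv : Measurable v) (hvY : MemLp (fun ω => v (M.Y ω)) 2 M.P) :
    M.mmse ≤ ∫ ω, (‖M.X ω‖ - v (M.Y ω)) ^ 2 ∂M.P :=
  integral_sub_condExp_sq_le M.measurable_Y.comap_le M.memLp_norm_X hvY
    (hv.comp (comap_measurable M.Y)).stronglyMeasurable

lemma le_mmse {c : ℝ}
    (h : ∀ ω, ∀ v : E → ℝ, Measurable v →
      MemLp (fun p => ‖p.1‖ - v (M.B ω p.1 + σ • p.2)) 2
        ((stdGaussian E).prod (stdGaussian E)) →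
      c ≤ ∫ p, (‖p.1‖ - v (M.B ω p.1 + σ • p.2)) ^ 2 ∂(stdGaussian E).prod (stdGaussian E)) :
    c ≤ M.mmse := by
  obtain ⟨v, hv, hestimator⟩ : ∃ v : E → ℝ, Measurable v ∧ M.estimator = v ∘ M.Y :=
    (stronglyMeasurable_condExp (m := MeasurableSpace.comap M.Y inferInstance)
      (f := fun ω => ‖M.X ω‖) (μ := M.P)).measurable.exists_eq_measurable_comp
  let F (q : (E →L[ℝ] E) × E × E) : ℝ := ‖q.2.1‖ - v (q.1 q.2.1 + q.2.2)
  have hF : Measurable F := by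
    have := measurable_clm_apply (measurable_fst (α := E →L[ℝ] E) (β := E × E))
      (measurable_fst.comp measurable_snd)
    fun_prop
  have hident := M.identDistrib_B_X_N.comp hF
  have herror : (fun ω => ‖M.X ω‖ - M.estimator ω) =
      F ∘ fun ω => (M.B ω, M.X ω, M.N ω) := by
    rw [hestimator]
    rfl
  have hmem : MemLp (F ∘ fun ω => (M.B ω, M.X ω, M.N ω)) 2 M.P :=
    herror ▸ M.memLp_norm_X.sub (M.memLp_norm_X.condExp one_le_two)
  have hmem' := hident.memLp_snd hmem
  have hmmse : M.mmse = _ :=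
    (integral_congr_ae (.of_forall fun ω => congrArg (· ^ 2) (congrFun herror ω))).trans
      (hident.sq.integral_eq.trans (integral_prod _ hmem'.integrable_sq))
  calc c = ∫ _, c ∂M.P := by simp
    _ ≤ M.mmse := by
      rw [hmmse]
      refine integral_mono_ae (integrable_const _) hmem'.integrable_sq.integral_prod_left ?_
      filter_upwards [memLp_prodMk_left_ae hmem'] with ω hω
      exact h ω v hv hω

end ProjectionModel

lemma tendsto_inv_sqrt_one_add_sq : Tendsto (fun σ : ℝ => (√(1 + σ ^ 2))⁻¹) atTop (𝓝 0) := by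
  refine tendsto_inv_atTop_zero.comp (tendsto_atTop_mono (fun σ => ?_) tendsto_id)
  exact Real.le_sqrt_of_sq_le (le_add_of_nonneg_left zero_le_one)

lemma mul_inv_sqrt_one_add_sq_sq_add (σ : ℝ) :
    (σ * (√(1 + σ ^ 2))⁻¹) ^ 2 + (√(1 + σ ^ 2))⁻¹ ^ 2 = 1 := by
  rw [mul_pow, ← add_one_mul, inv_pow, Real.sq_sqrt (by positivity), add_comm,
    mul_inv_cancel₀ (by positivity)]

lemma mul_inv_sqrt_one_add_sq_le_one (σ : ℝ) : σ * (√(1 + σ ^ 2))⁻¹ ≤ 1 :=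
  le_of_abs_le ((sq_le_one_iff_abs_le_one _).1 ((le_add_of_nonneg_right (sq_nonneg _)).trans_eq
    (mul_inv_sqrt_one_add_sq_sq_add σ)))

lemma tendsto_mul_inv_sqrt_one_add_sq :
    Tendsto (fun σ : ℝ => σ * (√(1 + σ ^ 2))⁻¹) atTop (𝓝 1) := by
  have h : Tendsto (fun σ : ℝ => √(1 - (√(1 + σ ^ 2))⁻¹ ^ 2)) atTop (𝓝 √(1 - 0 ^ 2)) :=
    ((tendsto_inv_sqrt_one_add_sq.pow 2).const_sub 1).sqrt
  rw [zero_pow two_ne_zero, sub_zero, Real.sqrt_one] at h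
  refine h.congr' ?_
  filter_upwards [eventually_ge_atTop 0] with σ hσ
  rw [← eq_sub_of_add_eq (mul_inv_sqrt_one_add_sq_sq_add σ), Real.sqrt_sq (by positivity)]

namespace ProjectionModel

variable {E : Type*} [NormedAddCommGroup E] [InnerProductSpace ℝ E] [FiniteDimensional ℝ E]
  [MeasurableSpace E] [BorelSpace E] {σ : ℝ} (M : ProjectionModel.{u} E σ)

lemma mmse_le_integral_norm_sub_const_sq (c : ℝ) :
    M.mmse ≤ ∫ x, (‖x‖ - c) ^ 2 ∂stdGaussian E := by
  have h : Measurable fun x : E => (‖x‖ - c) ^ 2 := by fun_prop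
  rw [← M.law_X, integral_map M.measurable_X.aemeasurable h.aestronglyMeasurable]
  exact M.mmse_le measurable_const (memLp_const c)

lemma mmse_le_variance_norm : M.mmse ≤ Var[fun x => ‖x‖; stdGaussian E] := by
  refine (M.mmse_le_integral_norm_sub_const_sq (∫ x, ‖x‖ ∂stdGaussian E)).trans_eq ?_
  rw [variance_eq_integral (by fun_prop)]

lemma memLp_norm_B_X : MemLp (fun ω => ‖M.B ω (M.X ω)‖) 2 M.P :=
  M.memLp_norm_X.mono M.measurable_B_X.norm.aestronglyMeasurable
    (.of_forall fun ω => by simpa only [norm_norm] using M.norm_B_apply_le ω (M.X ω))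

lemma identDistrib_norm_N :
    IdentDistrib (fun ω => ‖M.N ω‖) (fun x : E => |σ| * ‖x‖) M.P (stdGaussian E) := by
  have h : IdentDistrib M.N (fun x => σ • x) M.P (stdGaussian E) :=
    ⟨M.measurable_N.aemeasurable, by fun_prop, M.law_N⟩
  simpa only [Function.comp_def, norm_smul, Real.norm_eq_abs] using h.norm

lemma memLp_norm_N : MemLp (fun ω => ‖M.N ω‖) 2 M.P :=
  M.identDistrib_norm_N.memLp_iff.2 ((memLp_norm_stdGaussian ENNReal.ofNat_ne_top).const_mul _)

lemma lpNorm_norm_N : lpNorm (fun ω => ‖M.N ω‖) 2 M.P = |σ| * √(Module.finrank ℝ E) := by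
  have hscale := lpNorm_const_smul (p := 2) |σ| (fun x : E => ‖x‖) (stdGaussian E)
  rw [lpNorm_norm_stdGaussian, coe_nnnorm, Real.norm_eq_abs, abs_abs] at hscale
  rw [← hscale, ← toReal_eLpNorm M.memLp_norm_N.1, M.identDistrib_norm_N.eLpNorm_eq,
    toReal_eLpNorm (by fun_prop)]
  rfl

lemma memLp_norm_Y : MemLp (fun ω => ‖M.Y ω‖) 2 M.P := by
  refine (M.memLp_norm_B_X.add M.memLp_norm_N).mono
    M.measurable_Y.norm.aestronglyMeasurable (.of_forall fun ω => ?_)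
  rw [norm_norm]
  exact (norm_add_le _ _).trans (le_abs_self _)

lemma mmse_le_two : M.mmse ≤ 2 :=
  M.mmse_le_variance_norm.trans (variance_norm_stdGaussian_le_two E)

section ConstantRank

variable {n K J : ℕ} (hn : Module.finrank ℝ E = n) (hKJ : K + J = n)
  (hK : ∀ ω, Module.finrank ℝ (M.B ω).range = K)

include hn hKJ hK

lemma exists_B_eq_starProjection_of_finrank (ω : M.Ω) :
    ∃ U : Submodule ℝ E, M.B ω = U.starProjection ∧ Module.finrank ℝ U = K ∧
      Module.finrank ℝ Uᗮ = J := by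
  obtain ⟨U, hU, hrank⟩ := M.exists_B_eq_starProjection ω
  rw [hK] at hrank
  exact ⟨U, hU, hrank, U.finrank_add_finrank_orthogonal' (by rw [hrank, hKJ, hn])⟩

lemma sub_condMeanNormSq_le_mmse : n - condMeanNormSq K J ≤ M.mmse := by
  refine M.le_mmse fun ω v _ hint => ?_
  obtain ⟨U, hU, rfl, rfl⟩ := M.exists_B_eq_starProjection_of_finrank hn hKJ hK ω
  rw [hU] at hint ⊢
  exact hn ▸ sub_condMeanNormSq_le_integral_starProjection_add U (g := fun z => σ • z)
    hint.integrable_sq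

lemma integral_norm_sub_condMeanNorm_B_X_sq :
    ∫ ω, (‖M.X ω‖ - condMeanNorm J ‖M.B ω (M.X ω)‖) ^ 2 ∂M.P = n - condMeanNormSq K J := by
  have hmeas : Measurable (condMeanNorm J) := (continuous_condMeanNorm J).measurable
  have hF : Measurable fun q : (E →L[ℝ] E) × E × E => ‖q.2.1‖ - condMeanNorm J ‖q.1 q.2.1‖ := by
    have := measurable_clm_apply (measurable_fst (α := E →L[ℝ] E) (β := E × E))
      (measurable_fst.comp measurable_snd)
    fun_prop
  have hident := M.identDistrib_B_X_N.comp hF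
  have hmem := hident.memLp_snd
    (M.memLp_norm_X.sub (memLp_condMeanNorm J M.memLp_norm_B_X) :)
  refine hident.sq.integral_eq.trans ((integral_prod _ hmem.integrable_sq).trans ?_)
  have hsections (ω : M.Ω) : ∫ p : E × E, (‖p.1‖ - condMeanNorm J ‖M.B ω p.1‖) ^ 2
      ∂(stdGaussian E).prod (stdGaussian E) = n - condMeanNormSq K J := by
    obtain ⟨U, hU, rfl, rfl⟩ := M.exists_B_eq_starProjection_of_finrank hn hKJ hK ω
    rw [integral_fun_fst fun x => (‖x‖ - condMeanNorm (Module.finrank ℝ Uᗮ) ‖M.B ω x‖) ^ 2, hU,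
      integral_norm_sub_condMeanNorm_starProjection_sq, hn, probReal_univ, one_smul]
  simp only [Function.comp_apply, hsections, integral_const, probReal_univ, one_smul]

lemma sqrt_mmse_le : √M.mmse ≤ √(n - condMeanNormSq K J) + |σ| * √n := by
  have hBX := memLp_condMeanNorm J M.memLp_norm_B_X
  have hY := memLp_condMeanNorm J M.memLp_norm_Y
  have hmeas : Measurable fun y : E => condMeanNorm J ‖y‖ :=
    (continuous_condMeanNorm J).measurable.comp measurable_norm
  calc √M.mmse ≤ lpNorm (fun ω => ‖M.X ω‖ - condMeanNorm J ‖M.Y ω‖) 2 M.P := by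
        refine (Real.sqrt_le_left lpNorm_nonneg).2 ?_
        exact (M.mmse_le hmeas hY).trans_eq (sq_lpNorm_two (M.memLp_norm_X.sub hY).1).symm
    _ ≤ lpNorm (fun ω => ‖M.X ω‖ - condMeanNorm J ‖M.B ω (M.X ω)‖) 2 M.P +
          lpNorm (fun ω => condMeanNorm J ‖M.B ω (M.X ω)‖ - condMeanNorm J ‖M.Y ω‖) 2 M.P :=
        lpNorm_sub_le_lpNorm_sub_add_lpNorm_sub M.memLp_norm_X hBX one_le_two
    _ ≤ √(n - condMeanNormSq K J) + lpNorm (fun ω => ‖M.N ω‖) 2 M.P := by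
        refine add_le_add (le_of_eq ?_) (lpNorm_mono_real M.memLp_norm_N fun ω => ?_)
        · rw [← M.integral_norm_sub_condMeanNorm_B_X_sq hn hKJ hK,
            ← Real.sqrt_sq (lpNorm_nonneg (μ := M.P))]
          exact congrArg _ (sq_lpNorm_two (M.memLp_norm_X.sub hBX).1)
        · refine (abs_condMeanNorm_sub_le J _ _).trans ((abs_norm_sub_norm_le _ _).trans_eq ?_)
          rw [Y, sub_add_cancel_left, norm_neg]
    _ = √(n - condMeanNormSq K J) + |σ| * √n := by rw [M.lpNorm_norm_N, hn]

end ConstantRank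

lemma sqrt_variance_sub_le_sqrt_mmse {s c : ℝ} (hsc : s ^ 2 + c ^ 2 = 1) (hs : s ≤ 1)
    (hc : 0 < c) (hσ : σ = s / c) :
    √Var[fun x => ‖x‖; stdGaussian E] -
      ((1 - s) * √(Module.finrank ℝ E) + c * √(Module.finrank ℝ E)) ≤ √M.mmse := by
  rcases le_total (√Var[fun x => ‖x‖; stdGaussian E] -
      ((1 - s) * √(Module.finrank ℝ E) + c * √(Module.finrank ℝ E))) 0 with h | h
  · exact h.trans (Real.sqrt_nonneg _)
  subst hσ
  refine Real.le_sqrt_of_sq_le (M.le_mmse fun ω v hv hint => ?_)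
  obtain ⟨U, hU, -⟩ := M.exists_B_eq_starProjection ω
  rw [hU] at hint ⊢
  rw [← sq_lpNorm_two hint.1]
  exact pow_le_pow_left₀ h (sqrt_variance_sub_le_lpNorm U hsc hs hc hv hint) 2

section Limits

variable (M : (σ : ℝ) → ProjectionModel.{u} E σ)

lemma tendsto_mmse_zero_noise {n K J : ℕ} (hn : Module.finrank ℝ E = n) (hKJ : K + J = n)
    (hK : ∀ σ ω, Module.finrank ℝ ((M σ).B ω).range = K) :
    Tendsto (fun σ => (M σ).mmse) (𝓝 0) (𝓝 (n - condMeanNormSq K J)) := by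
  have hnonneg : 0 ≤ (n : ℝ) - condMeanNormSq K J := by
    rw [← (M 0).integral_norm_sub_condMeanNorm_B_X_sq hn hKJ (hK 0)]
    exact integral_nonneg fun _ => sq_nonneg _
  have hlim : Tendsto (fun σ : ℝ => (√(n - condMeanNormSq K J) + |σ| * √n) ^ 2) (𝓝 0)
      (𝓝 (n - condMeanNormSq K J)) := by
    have hcont : Continuous fun σ : ℝ => (√(n - condMeanNormSq K J) + |σ| * √n) ^ 2 := by
      fun_prop
    simpa only [abs_zero, zero_mul, add_zero, Real.sq_sqrt hnonneg] using hcont.tendsto 0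
  exact tendsto_of_tendsto_of_tendsto_of_le_of_le tendsto_const_nhds hlim
    (fun σ => (M σ).sub_condMeanNormSq_le_mmse hn hKJ (hK σ))
    fun σ => (Real.sqrt_le_left (by positivity)).1 ((M σ).sqrt_mmse_le hn hKJ (hK σ))

lemma tendsto_mmse_infinite_noise :
    Tendsto (fun σ => (M σ).mmse) atTop (𝓝 Var[fun x => ‖x‖; stdGaussian E]) := by
  have hlim := ((tendsto_mul_inv_sqrt_one_add_sq.const_sub 1).mul_const
    √(Module.finrank ℝ E)).add (tendsto_inv_sqrt_one_add_sq.mul_const √(Module.finrank ℝ E))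
    |>.const_sub √Var[fun x => ‖x‖; stdGaussian E]
  rw [sub_self, zero_mul, zero_add, sub_zero] at hlim
  have hsqrt : Tendsto (fun σ => √(M σ).mmse) atTop (𝓝 √Var[fun x => ‖x‖; stdGaussian E]) :=
    tendsto_of_tendsto_of_tendsto_of_le_of_le hlim tendsto_const_nhds
      (fun σ => (M σ).sqrt_variance_sub_le_sqrt_mmse (mul_inv_sqrt_one_add_sq_sq_add σ)
        (mul_inv_sqrt_one_add_sq_le_one σ) (by positivity) (by field_simp))
      fun σ => Real.sqrt_le_sqrt (M σ).mmse_le_variance_norm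
  have h := hsqrt.pow 2
  rw [Real.sq_sqrt (variance_nonneg _ _)] at h
  exact h.congr fun σ => Real.sq_sqrt (M σ).mmse_nonneg

end Limits

end ProjectionModel

lemma summable_hypergeometricTerm_condMeanNormSq {n K J : ℕ} (hn : 0 < n) (h : K + J = n) :
    Summable (hypergeometricTerm [((n : ℝ) + 1) / 2, (J : ℝ) / 2, -(1 / 2)]
      [((n : ℝ) + J + 1) / 2, (n : ℝ) / 2] 1) := by
  have : (0 : ℝ) < n := Nat.cast_pos.2 hn
  refine (summable_mul_left_iff (mul_pos (by positivity) (div_pos ?_ ?_)).ne').1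
    (hasSum_condMeanNormSq hn h).summable <;>
  exact beta_pos (by positivity) (by positivity)

lemma condMeanNormSq_eq_hypergeometricPFQ {n K J : ℕ} (hn : 0 < n) (h : K + J = n) :
    condMeanNormSq K J = ((n : ℝ) + J) *
      (beta (((n : ℝ) + J) / 2) (((n : ℝ) + 1) / 2) / beta (((n : ℝ) + J + 1) / 2) ((n : ℝ) / 2)) *
      hypergeometricPFQ [((n : ℝ) + 1) / 2, (J : ℝ) / 2, -(1 / 2)]
        [((n : ℝ) + J + 1) / 2, (n : ℝ) / 2] 1 := by
  rw [hypergeometricPFQ, ← tsum_mul_left, (hasSum_condMeanNormSq hn h).tsum_eq]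

lemma variance_norm_stdGaussian (E : Type*) [NormedAddCommGroup E] [InnerProductSpace ℝ E]
    [FiniteDimensional ℝ E] [MeasurableSpace E] [BorelSpace E] [Nontrivial E] :
    Var[fun x => ‖x‖; stdGaussian E] = Module.finrank ℝ E -
      2 * (Real.Gamma (((Module.finrank ℝ E : ℝ) + 1) / 2) /
        Real.Gamma ((Module.finrank ℝ E : ℝ) / 2)) ^ 2 := by
  rw [variance_eq_sub (memLp_norm_stdGaussian ENNReal.ofNat_ne_top), integral_norm_stdGaussian,
    mul_pow, Real.sq_sqrt zero_le_two]
  exact congrArg (· - _) (integral_norm_sq_stdGaussian E)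

lemma ProjectionModel.tendsto_mmse_div_finrank {E : ℕ → Type*} [∀ j, NormedAddCommGroup (E j)]
    [∀ j, InnerProductSpace ℝ (E j)] [∀ j, FiniteDimensional ℝ (E j)]
    [∀ j, MeasurableSpace (E j)] [∀ j, BorelSpace (E j)] {σ : ℕ → ℝ}
    (M : ∀ j, ProjectionModel.{u} (E j) (σ j))
    (h : Tendsto (fun j => Module.finrank ℝ (E j)) atTop atTop) :
    Tendsto (fun j => (M j).mmse / Module.finrank ℝ (E j)) atTop (𝓝 0) := by
  refine tendsto_of_tendsto_of_tendsto_of_le_of_le tendsto_const_nhds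
    ((tendsto_natCast_atTop_atTop.comp h).const_div_atTop 2)
    (fun j => div_nonneg (M j).mmse_nonneg (Nat.cast_nonneg _))
    fun j => div_le_div_of_nonneg_right (M j).mmse_le_two (Nat.cast_nonneg _)

section DiagonalModel

variable {ι : Type*} [Fintype ι] [DecidableEq ι]

lemma map_smul_stdGaussian_eq_multivariateGaussian (σ : ℝ) :
    (stdGaussian (EuclideanSpace ℝ ι)).map (fun x => σ • x) =
      multivariateGaussian 0 (σ ^ 2 • (1 : Matrix ι ι ℝ)) := by
  refine Measure.ext_of_charFun (funext fun t => ?_)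
  rw [charFun_map_smul, charFun_multivariateGaussian (Matrix.PosSemidef.one.smul (sq_nonneg σ)),
    charFun_stdGaussian]
  have ht : t.ofLp ⬝ᵥ t.ofLp = ‖t‖ ^ 2 := by
    rw [EuclideanSpace.real_norm_sq_eq]
    simp only [dotProduct, sq]
  rw [Matrix.smul_mulVec, Matrix.one_mulVec, dotProduct_smul, ht, norm_smul, inner_zero_right]
  simp [mul_pow, neg_div, ← Complex.ofReal_pow]

lemma measurable_toEuclideanCLM_diagonal {α : Type*} [MeasurableSpace α] {b : α → ι → ℝ}
    (hb : Measurable b) :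
    Measurable fun a => Matrix.toEuclideanCLM (𝕜 := ℝ) (Matrix.diagonal (b a)) := by
  have h : Continuous fun d : ι → ℝ => Matrix.toEuclideanCLM (𝕜 := ℝ) (Matrix.diagonal d) :=
    LinearMap.continuous_of_finiteDimensional
      ((Matrix.toEuclideanCLM (n := ι) (𝕜 := ℝ)).toAlgEquiv.toLinearMap ∘ₗ
        Matrix.diagonalLinearMap ι ℝ ℝ)
  exact h.measurable.comp hb

lemma isStarProjection_diagonal {b : ι → ℝ} (hb : ∀ i, b i = 0 ∨ b i = 1) :
    IsStarProjection (Matrix.diagonal b) where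
  isIdempotentElem := by
    rw [IsIdempotentElem, Matrix.diagonal_mul_diagonal]
    exact congrArg _ (funext fun i => by rcases hb i with h | h <;> simp [h])
  isSelfAdjoint := by
    rw [IsSelfAdjoint, Matrix.star_eq_conjTranspose, Matrix.diagonal_conjTranspose, star_trivial]

lemma finrank_range_toEuclideanCLM_diagonal {b : ι → ℝ} {K : ℕ} (hb : ∀ i, b i = 0 ∨ b i = 1)
    (hsum : ∑ i, b i = K) :
    Module.finrank ℝ (Matrix.toEuclideanCLM (𝕜 := ℝ) (Matrix.diagonal b)).range = K := by
  have hterm (i : ι) : b i = if b i ≠ 0 then 1 else 0 := by rcases hb i with h | h <;> simp [h]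
  rw [Finset.sum_congr rfl fun i _ => hterm i, Finset.sum_boole, Nat.cast_inj] at hsum
  rw [← hsum, ← Fintype.card_subtype, ← Matrix.rank_diagonal b]
  exact (Matrix.rank_eq_finrank_range_toLin _ (PiLp.basisFun 2 ℝ ι) (PiLp.basisFun 2 ℝ ι)).symm

end DiagonalModel

namespace MeasurementModel

variable {n K : ℕ} {σ : ℝ} (M : MeasurementModel.{u} n K σ)

/-- The measurement model with diagonal `B`, seen as a model with a random orthogonal projection:
`B ω` is the projection onto the span of the coordinate vectors selected by `b ω`. The two models
have definitionally equal `Y`, `estimator` and `mmse`. -/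
noncomputable def toProjectionModel : ProjectionModel.{u} (EuclideanSpace ℝ (Fin n)) σ where
  Ω := M.Ω
  P := M.P
  X := M.X
  N := M.N
  B ω := Matrix.toEuclideanCLM (𝕜 := ℝ) (Matrix.diagonal (M.b ω))
  measurable_X := M.measurable_X
  measurable_N := M.measurable_N
  measurable_B := measurable_toEuclideanCLM_diagonal M.measurable_b
  isStarProjection_B ω := (isStarProjection_diagonal (M.b_zero_or_one ω)).map _
  law_X := M.law_X.trans multivariateGaussian_zero_one
  law_N := M.law_N.trans (map_smul_stdGaussian_eq_multivariateGaussian σ).symm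
  indep_X_N := M.indep_X_N
  indep_B_XN := M.indep_b_XN.comp (measurable_toEuclideanCLM_diagonal measurable_id) measurable_id

lemma finrank_range_toProjectionModel_B (ω : M.Ω) :
    Module.finrank ℝ (M.toProjectionModel.B ω).range = K :=
  finrank_range_toEuclideanCLM_diagonal (M.b_zero_or_one ω) (M.sum_b ω)

end MeasurementModel

universe v

theorem theorem3_general :
    (∀ {E : Type v} [NormedAddCommGroup E] [InnerProductSpace ℝ E] [FiniteDimensional ℝ E]
      [MeasurableSpace E] [BorelSpace E] {n K J : ℕ}, 0 < n → Module.finrank ℝ E = n →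
      K + J = n → ∀ M : (σ : ℝ) → ProjectionModel.{u} E σ,
      (∀ σ ω, Module.finrank ℝ ((M σ).B ω).range = K) →
      Summable (hypergeometricTerm [((n : ℝ) + 1) / 2, (J : ℝ) / 2, -(1 / 2)]
        [((n : ℝ) + J + 1) / 2, (n : ℝ) / 2] 1) ∧
      Tendsto (fun σ : ℝ => (M σ).mmse) (𝓝[>] 0)
        (𝓝 ((n : ℝ) - ((n : ℝ) + J) *
          (beta (((n : ℝ) + J) / 2) (((n : ℝ) + 1) / 2) /
            beta (((n : ℝ) + J + 1) / 2) ((n : ℝ) / 2)) *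
          hypergeometricPFQ [((n : ℝ) + 1) / 2, (J : ℝ) / 2, -(1 / 2)]
            [((n : ℝ) + J + 1) / 2, (n : ℝ) / 2] 1))) ∧
    (∀ {E : Type v} [NormedAddCommGroup E] [InnerProductSpace ℝ E] [FiniteDimensional ℝ E]
      [MeasurableSpace E] [BorelSpace E] {n : ℕ}, 0 < n → Module.finrank ℝ E = n →
      ∀ M : (σ : ℝ) → ProjectionModel.{u} E σ,
      Tendsto (fun σ : ℝ => (M σ).mmse) atTop
        (𝓝 ((n : ℝ) - 2 * (Real.Gamma (((n : ℝ) + 1) / 2) / Real.Gamma ((n : ℝ) / 2)) ^ 2))) ∧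
    (∀ {E : ℕ → Type v} [∀ j, NormedAddCommGroup (E j)] [∀ j, InnerProductSpace ℝ (E j)]
      [∀ j, FiniteDimensional ℝ (E j)] [∀ j, MeasurableSpace (E j)] [∀ j, BorelSpace (E j)]
      {σ : ℕ → ℝ} {n : ℕ → ℕ}, Tendsto n atTop atTop → (∀ j, Module.finrank ℝ (E j) = n j) →
      ∀ M : (j : ℕ) → ProjectionModel.{u} (E j) (σ j),
        Tendsto (fun j : ℕ => (M j).mmse / (n j : ℝ)) atTop (𝓝 0)) := by
  refine ⟨fun hn hE hKJ M hK => ⟨summable_hypergeometricTerm_condMeanNormSq hn hKJ, ?_⟩,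
    fun hn hE M => ?_, fun hn hE M => ?_⟩
  · rw [← condMeanNormSq_eq_hypergeometricPFQ hn hKJ]
    exact (ProjectionModel.tendsto_mmse_zero_noise M hE hKJ hK).mono_left nhdsWithin_le_nhds
  · subst hE
    have := Module.nontrivial_of_finrank_pos hn
    rw [← variance_norm_stdGaussian]
    exact ProjectionModel.tendsto_mmse_infinite_noise M
  · obtain rfl := funext hE
    exact ProjectionModel.tendsto_mmse_div_finrank M hn

theorem theorem3 :
    -- the limit of vanishing noise, with `J = n - K`
    (∀ n K J : ℕ, 1 ≤ n → K + J = n → ∀ M : (σ : ℝ) → MeasurementModel.{u} n K σ,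
      Summable (hypergeometricTerm [((n : ℝ) + 1) / 2, (J : ℝ) / 2, -(1 / 2)]
        [((n : ℝ) + J + 1) / 2, (n : ℝ) / 2] 1) ∧
      Tendsto (fun σ : ℝ => (M σ).mmse) (𝓝[>] 0)
        (𝓝 ((n : ℝ) - ((n : ℝ) + J) *
          (ProbabilityTheory.beta (((n : ℝ) + J) / 2) (((n : ℝ) + 1) / 2) /
            ProbabilityTheory.beta (((n : ℝ) + J + 1) / 2) ((n : ℝ) / 2)) *
          hypergeometricPFQ [((n : ℝ) + 1) / 2, (J : ℝ) / 2, -(1 / 2)]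
            [((n : ℝ) + J + 1) / 2, (n : ℝ) / 2] 1))) ∧
    -- the limit of infinite noise
    (∀ n K : ℕ, 1 ≤ n → K ≤ n → ∀ M : (σ : ℝ) → MeasurementModel.{u} n K σ,
      Tendsto (fun σ : ℝ => (M σ).mmse) atTop
        (𝓝 ((n : ℝ) - 2 * (Real.Gamma (((n : ℝ) + 1) / 2) / Real.Gamma ((n : ℝ) / 2)) ^ 2))) ∧
    -- the limit of infinite dimension; the ratio `K / n` in `[1 / n, 1]` may be constant or vary
    (∀ σ : ℝ, 0 < σ → ∀ n K : ℕ → ℕ, Tendsto n atTop atTop →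
      (∀ j, 1 ≤ K j ∧ K j ≤ n j) →
      ∀ M : (j : ℕ) → MeasurementModel.{u} (n j) (K j) σ,
        Tendsto (fun j : ℕ => (M j).mmse / (n j : ℝ)) atTop (𝓝 0)) :=
  ⟨fun _ _ _ hn hKJ M => theorem3_general.1 hn finrank_euclideanSpace_fin hKJ
      (fun σ => (M σ).toProjectionModel) fun σ => (M σ).finrank_range_toProjectionModel_B,
    fun _ _ hn _ M => theorem3_general.2.1 hn finrank_euclideanSpace_fin
      fun σ => (M σ).toProjectionModel,
    fun _ _ _ _ hn _ M => theorem3_general.2.2 hn (fun _ => finrank_euclideanSpace_fin)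
      fun j => (M j).toProjectionModel⟩
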